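/- Let $\mathcal G$ be a finite directed graph (loops allowed) on a nonempty set $\mathcal X$ of $n$ states; a link $x_j\to x_i$ means that the entry $a_{ij}$ of the system matrix $A\in\mathbb R^{n\times n}$ is a nonzero free parameter, all other entries being zero. There are $N$ agents; agent $i$ takes one measurement, of one state $x_{s(i)}$, so row $H_i$ of $H\in\mathbb R^{N\times n}$ has exactly one nonzero entry, in column $s(i)$ (also a free parameter). The choice $s$ is *structurally observable* if some such pair $(A,H)$ is observable in the sense of Kalman, and *generically observable* if almost all such pairs (for Lebesgue measure on the parameters) are. For distributed observability ($N\ge1$), the agents also have a prediction network and a measurement network, with neighborhoods $\mathcal N_\beta(i)\ni i$ and $\mathcal N_\alpha(i)\ni i$; $W$ is a row-stochastic $N\times N$ matrix with $w_{ij}>0$ if $j\in\mathcal N_\beta(i)$ and $w_{ij}=0$ otherwise, and $D_H$ is the block-diagonal matrix with blocks $\sum_{j\in\mathcal N_\alpha(i)}H_j^\top H_j$. The design is structurally (generically) *distributedly observable* if $(W\otimes A,D_H)$ is observable for some (almost all) values of the parameters of $A$, $H$, $W$; here "almost all" refers to Lebesgue measure on the parameters of $A$ and $H$ and on positive weights $p_{ij}$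 with $w_{ij}=p_{ij}/\sum_{k\in\mathcal N_\beta(i)}p_{ik}$. Let $\mathcal M$ be a maximum matching of $\mathcal G$, i.e. a largest set of links no two of which have the same tail or the same head, and let $\delta\mathcal M$ be the set of states that are not the tail of a link in $\mathcal M$. For $v\in\delta\mathcal M$, the *contraction* of $v$ is the set of all states reachable from $v$ by $\mathcal M$-alternating paths: from a state $x$ one goes along a link $x\to y$ outside $\mathcal M$ and then back along the link $x'\to y$ in $\mathcal M$ to $x'$ (paths of length zero are allowed). Let $\mathcal C$ be the set of contractions, and $\mathcal S^p$ the set of *parent SCCs*, the strongly connected components with no outgoing link to another component. The S-rank of a structured matrix is the largest rank of a real matrix with exactly that zero/nonzero pattern; for a set $T$ of states, $H_T$ is the structured measurement matrix with one row per $x\in T$, measuring $x$. Let $|\mathcal S^p\cap\mathcal C|$ denote the largest size of a set $T$ of states such that * the states in $T$ can be assigned to distinct contractions containing them and to distinct parent SCCs containing them, and * $\text{S-rank}\begin{pmatrix}A\\H_T\end{pmatrix}=\text{S-rank}(A)+|T|$, i.e. each of these measurements raises the S-rank by one. Then: 1. The minimum number $N$ of agents for which there is a structurally observable choice of measured states is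 $$N_{\min}=|\mathcal C|+|\mathcal S^p|-|\mathcal S^p\cap\mathcal C| .$$ The same number is the minimum for generic observability, and the minimum number $N\ge1$ of agents for which there are measured states and two networks giving structural distributed observability, or generic distributed observability. 2. If the contractions are pairwise disjoint, then $|\mathcal S^p\cap\mathcal C|$ is simply the largest number of disjoint pairs (contraction, parent SCC) having a common state. 3. If $\mathcal G$ is structurally full-rank, i.e. $\text{S-rank}(A)=n$, then there are no contractions and the minimum number in each of the four senses of part 1 is $N_{\min}=|\mathcal S^p|$. -/

import Mathlib

open Matrix MeasureTheory
open scoped Kronecker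

noncomputable section

namespace SocialObs

/-! ## Structured systems

A social digraph is `G : Digraph V`; `G.Adj x y` is the link `x → y`, i.e. the entry of the system
matrix in row `y` and column `x` is a free nonzero parameter (and it is a fixed zero otherwise). -/

/-- The zero/nonzero pattern `P` is exactly the pattern of the numerical matrix `B`. -/
def HasPattern {m n : Type*} (P : Matrix m n Prop) (B : Matrix m n ℝ) : Prop :=
  ∀ i j, B i j ≠ 0 ↔ P i j

/-- The structured system matrix of the digraph (row = head of the link, column = tail). -/
def systemPattern {V : Type*} (G : Digraph V) : Matrix V V Prop :=
  Matrix.of fun y x => G.Adj x y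

/-- The structured measurement matrix: row `i` measures the single state `s i`. -/
def sensorPattern {ι V : Type*} (s : ι → V) : Matrix ι V Prop :=
  Matrix.of fun i x => x = s i

/-- S-rank of a structured matrix: the largest rank of a numerical matrix with that pattern. -/
def sRank {m n : Type*} [Fintype n] (P : Matrix m n Prop) : ℕ :=
  sSup {r | ∃ B : Matrix m n ℝ, HasPattern P B ∧ B.rank = r}

/-- Kalman observability of the pair `(A, C)` of `x⁺ = A x`, `y = C x`: an initial state whose
whole output sequence vanishes is zero. -/
def Observable {m n : Type*} [Fintype n] [DecidableEq n]
    (A : Matrix n n ℝ) (C : Matrix m n ℝ) : Prop :=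
  ∀ x : n → ℝ, (∀ k : ℕ, (C * A ^ k) *ᵥ x = 0) → x = 0

/-! ### Numerical realizations used for statements about almost all parameter values -/

/-- The system matrix with structure `G` and parameters `θ`. -/
def systemMatrix {V : Type*} (G : Digraph V) (θ : V → V → ℝ) : Matrix V V ℝ :=
  open Classical in Matrix.of fun y x => if G.Adj x y then θ y x else 0

/-- The measurement matrix whose row `i` is `h i` times the coordinate of the state `s i`. -/
def sensorMatrix {ι V : Type*} (s : ι → V) (h : ι → ℝ) : Matrix ι V ℝ :=
  open Classical in Matrix.of fun i x => if x = s i then h i else 0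

/-- The row-stochastic matrix obtained by normalizing positive weights `p` over the
neighborhoods `β`. -/
def weightMatrix {ι : Type*} [DecidableEq ι] (β : ι → Finset ι) (p : ι → ι → ℝ) : Matrix ι ι ℝ :=
  Matrix.of fun i j => if j ∈ β i then p i j / ∑ k ∈ β i, p i k else 0

/-! ### Centralized structural observability -/

section Observability

variable {V : Type*} [Fintype V] [DecidableEq V] {N : ℕ}

/-- Structural observability: some realization of the two patterns is observable. -/
def StructObservable (G : Digraph V) (s : Fin N → V) : Prop :=
  ∃ (A : Matrix V V ℝ) (H : Matrix (Fin N) V ℝ),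
    HasPattern (systemPattern G) A ∧ HasPattern (sensorPattern s) H ∧ Observable A H

/-- Generic observability: almost all realizations are observable. -/
def GenericObservable (G : Digraph V) (s : Fin N → V) : Prop :=
  ∀ᵐ q : (V → V → ℝ) × (Fin N → ℝ),
    Observable (systemMatrix G q.1) (sensorMatrix s q.2)

/-! ### Distributed observability

Agent `i` takes the measurement of row `i` of `H`. Agents share predictions over the network with
neighborhoods `β` and measurements over the network with neighborhoods `α`; both neighborhoods of
an agent contain the agent. -/

/-- The block-diagonal matrix `D_H` with `i`-th block `∑ j ∈ α i, H_jᵀ H_j`. -/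
def localOutputs (H : Matrix (Fin N) V ℝ) (α : Fin N → Finset (Fin N)) :
    Matrix (Fin N × V) (Fin N × V) ℝ :=
  Matrix.of fun a b =>
    if a.1 = b.1 then (∑ j ∈ α a.1, Matrix.vecMulVec (H j) (H j)) a.2 b.2 else 0

/-- `W` is a row-stochastic matrix, positive exactly on the neighborhoods `β`. -/
def IsStochasticOn (β : Fin N → Finset (Fin N)) (W : Matrix (Fin N) (Fin N) ℝ) : Prop :=
  (∀ i j, 0 ≤ W i j) ∧ (∀ i, ∑ j, W i j = 1) ∧ ∀ i j, W i j ≠ 0 ↔ j ∈ β i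

/-- Each agent belongs to its own neighborhood. -/
def IsNeighborhood (β : Fin N → Finset (Fin N)) : Prop := ∀ i, i ∈ β i

/-- Structural distributed observability: `(W ⊗ A, D_H)` is observable for some values. -/
def StructDistObservable (G : Digraph V) (s : Fin N → V) (β α : Fin N → Finset (Fin N)) : Prop :=
  ∃ (A : Matrix V V ℝ) (H : Matrix (Fin N) V ℝ) (W : Matrix (Fin N) (Fin N) ℝ),
    HasPattern (systemPattern G) A ∧ HasPattern (sensorPattern s) H ∧ IsStochasticOn β W ∧
      Observable (W ⊗ₖ A) (localOutputs H α)

/-- Generic distributed observability: `(W ⊗ A, D_H)` is observable for almost all values. -/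
def GenericDistObservable (G : Digraph V) (s : Fin N → V) (β α : Fin N → Finset (Fin N)) : Prop :=
  ∀ᵐ q : (V → V → ℝ) × (Fin N → ℝ) × (Fin N → Fin N → ℝ),
    (∀ i j, 0 < q.2.2 i j) →
      Observable (weightMatrix β q.2.2 ⊗ₖ systemMatrix G q.1)
        (localOutputs (sensorMatrix s q.2.1) α)

/-- `n` is the minimum number of agents (each measuring one state) for observability and for
distributed observability, each of them both for some and for almost all parameter values.
A distributed scheme has at least one agent (with no agent there is no estimator, and the pair
`(W ⊗ A, D_H)` of size zero would be vacuously observable). -/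
def IsMinAgents (G : Digraph V) (n : ℕ) : Prop :=
  IsLeast {N : ℕ | ∃ s : Fin N → V, StructObservable G s} n ∧
  IsLeast {N : ℕ | ∃ s : Fin N → V, GenericObservable G s} n ∧
  IsLeast {N : ℕ | 0 < N ∧ ∃ (s : Fin N → V) (β α : Fin N → Finset (Fin N)),
    IsNeighborhood β ∧ IsNeighborhood α ∧ StructDistObservable G s β α} n ∧
  IsLeast {N : ℕ | 0 < N ∧ ∃ (s : Fin N → V) (β α : Fin N → Finset (Fin N)),
    IsNeighborhood β ∧ IsNeighborhood α ∧ GenericDistObservable G s β α} n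

end Observability

/-! ## Contractions -/

section Graph

variable {V : Type*}

/-- A matching of the bipartite representation: a set of links, no two of which share their tail
(in `V⁺`) or their head (in `V⁻`). -/
def IsMatching (G : Digraph V) (M : Finset (V × V)) : Prop :=
  (∀ e ∈ M, G.Adj e.1 e.2) ∧ Set.InjOn Prod.fst (M : Set (V × V)) ∧
    Set.InjOn Prod.snd (M : Set (V × V))

/-- A matching of maximum size. -/
def IsMaxMatching (G : Digraph V) (M : Finset (V × V)) : Prop :=
  IsMatching G M ∧ ∀ M', IsMatching G M' → M'.card ≤ M.card

/-- `δM`: the nodes of `V⁺` not incident to the matching. -/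
def unmatched (M : Finset (V × V)) : Set V := {x | ∀ y, (x, y) ∉ M}

/-- The auxiliary graph on `V⁺ ⊔ V⁻` (`Sum.inl` for `V⁺`, `Sum.inr` for `V⁻`): the links outside
the matching go from `V⁺` to `V⁻`, those of the matching are reversed. Its directed paths
starting in `δM` are the alternating paths. -/
def AuxEdge (G : Digraph V) (M : Finset (V × V)) : V ⊕ V → V ⊕ V → Prop
  | Sum.inl x, Sum.inr y => G.Adj x y ∧ (x, y) ∉ M
  | Sum.inr y, Sum.inl x => (x, y) ∈ M
  | _, _ => False

/-- The nodes of `V⁺` reachable from `v` by alternating paths. -/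
def contractionOf (G : Digraph V) (M : Finset (V × V)) (v : V) : Set V :=
  {x | Relation.ReflTransGen (AuxEdge G M) (Sum.inl v) (Sum.inl x)}

/-- The contractions: one for each unmatched node. -/
def contractions (G : Digraph V) (M : Finset (V × V)) : Set (Set V) :=
  contractionOf G M '' unmatched M

/-! ## Strongly connected components -/

/-- The strongly connected component of `x`. -/
def sccOf (G : Digraph V) (x : V) : Set V :=
  {y | Relation.ReflTransGen G.Adj x y ∧ Relation.ReflTransGen G.Adj y x}

/-- The parent SCCs: the strongly connected components without outgoing links. -/
def parentSCCs (G : Digraph V) : Set (Set V) :=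
  {S | S ∈ Set.range (sccOf G) ∧ ∀ x ∈ S, ∀ y, G.Adj x y → y ∈ S}

/-! ## Common measurements of contractions and parent SCCs -/

/-- The states in `T` are shared by distinct contractions and distinct parent SCCs: they can be
attributed, one each, to distinct contractions containing them, and likewise to distinct
parent SCCs. -/
def IsSharedFamily (G : Digraph V) (M : Finset (V × V)) (T : Finset V) : Prop :=
  (∃ c : V → Set V, Set.InjOn c T ∧ ∀ x ∈ T, c x ∈ contractions G M ∧ x ∈ c x) ∧
  (∃ S : V → Set V, Set.InjOn S T ∧ ∀ x ∈ T, S x ∈ parentSCCs G ∧ x ∈ S x)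

/-- Measuring the states in `T` recovers the S-rank by one for each of them. -/
def RecoversRank [Fintype V] (G : Digraph V) (T : Finset V) : Prop :=
  sRank (Matrix.fromRows (systemPattern G) (sensorPattern fun t : T => (t : V))) =
    sRank (systemPattern G) + T.card

/-- `|𝒮ᵖ ∩ 𝒞|`: the largest number of shared states, in distinct contractions and distinct parent
SCCs, whose measurements jointly recover the S-rank by one each. -/
def sharedNumber [Fintype V] (G : Digraph V) (M : Finset (V × V)) : ℕ :=
  sSup {k | ∃ T : Finset V, IsSharedFamily G M T ∧ RecoversRank G T ∧ T.card = k}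

/-- The largest number of disjoint pairs of a contraction and a parent SCC that share a state. -/
def sharedPairNumber (G : Digraph V) (M : Finset (V × V)) : ℕ :=
  sSup {k | ∃ T : Finset V, IsSharedFamily G M T ∧ T.card = k}

end Graph

end SocialObs

end

/-! Call a set of states matchable if it is the set of tails of a matching of the digraph. Matchable
sets are the independent sets of a transversal matroid, whose corank `n - |M|` is the number of
contractions. A choice of measured states is observable for some, equivalently almost all,
parameters iff (a) all states outside some matchable set are measured and (b) every state reaches a
measured one.

Necessity: the stacked matrix of `A` and `H` must have trivial kernel, and an initial state `e_x`
only excites states reachable from `x`. Sufficiency: `exists_observable_realization` builds one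
observable pair, adding the cycles of a matching one at a time with well-chosen gains; since
observability follows from a nonvanishing homogeneous polynomial minor, one pair yields almost all
(`ae_observable`).

Counting: by (a) and matroid exchange the measured set contains a cobase `Bᶜ`, of size `|𝒞|`; by (b)
it contains a representative of each parent SCC. What can be saved is the largest overlap of the
two. A set lies in some cobase iff measuring it raises the S-rank by its cardinality
(`recoversRank_iff`), and by Hall's theorem the states of a cobase lie in distinct contractions, so
this overlap is `|𝒮ᵖ ∩ 𝒞|`.

Distributed case: a row-stochastic `W` preserves consensus vectors, so distributed observability
forces centralized observability; conversely `W = 1` with all measurements shared gives `N`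
decoupled copies of the centralized problem.

If contractions are disjoint, unmatched roots can be exchanged for chosen states along disjoint
alternating paths, so the rank condition is automatic. At full S-rank the corank is zero. -/

namespace SocialObs

/-! ## Term rank of a pattern -/

section TermRank

variable {m n : Type*}

/-- The columns in `U` can be matched to distinct rows along entries of the pattern `P`. -/
def Matchable (P : Matrix m n Prop) (U : Finset n) : Prop :=
  ∃ f : n → m, Set.InjOn f U ∧ ∀ x ∈ U, P (f x) x

/-- **Hall's theorem**: `U` can be matched as soon as none of its subsets has fewer neighbors than
elements. -/
theorem matchable_of_card_le [Fintype m] [Nonempty m] {P : Matrix m n Prop} {U : Finset n}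
    (h : ∀ S ⊆ U, ∃ R : Finset m, S.card ≤ R.card ∧ ∀ y ∈ R, ∃ x ∈ S, P y x) :
    Matchable P U := by
  classical
  have hall : ∀ s : Finset U,
      s.card ≤ (s.biUnion fun x : U => Finset.univ.filter fun y => P y x).card := by
    intro s
    obtain ⟨R, hR, hRP⟩ := h (s.map (Function.Embedding.subtype _)) (by
      intro x hx
      obtain ⟨y, -, rfl⟩ := Finset.mem_map.1 hx
      exact y.2)
    rw [Finset.card_map] at hR
    refine hR.trans (Finset.card_le_card fun y hy => ?_)
    obtain ⟨x', hx', hP⟩ := hRP y hy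
    obtain ⟨z, hz, rfl⟩ := Finset.mem_map.1 hx'
    exact Finset.mem_biUnion.2 ⟨z, hz, by simpa using hP⟩
  obtain ⟨f, hf, hfP⟩ := (Finset.all_card_le_biUnion_card_iff_exists_injective _).1 hall
  refine ⟨fun x => if hx : x ∈ U then f ⟨x, hx⟩ else Classical.arbitrary m, ?_, ?_⟩
  · intro x hx y hy hxy
    have hx' : x ∈ U := hx
    have hy' : y ∈ U := hy
    simp only [hx', hy', dif_pos] at hxy
    exact congrArg Subtype.val (hf hxy)
  · intro x hx
    simpa [hx] using hfP ⟨x, hx⟩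

/-- `U` can be matched as soon as each of its subsets injects into its own neighborhood. -/
theorem matchable_of_exists_injOn [Fintype m] [Nonempty m] {P : Matrix m n Prop} {U : Finset n}
    (h : ∀ S ⊆ U, ∃ g : n → m, Set.InjOn g S ∧ ∀ x ∈ S, ∃ x' ∈ S, P (g x) x') :
    Matchable P U := by
  classical
  refine matchable_of_card_le fun S hS => ?_
  obtain ⟨g, hg, hgP⟩ := h S hS
  refine ⟨S.image g, (Finset.card_image_of_injOn hg).ge, fun y hy => ?_⟩
  obtain ⟨x, hx, rfl⟩ := Finset.mem_image.1 hy
  exact hgP x hx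

/-- Linearly independent columns can be matched to distinct rows along nonzero entries. -/
theorem matchable_of_linearIndependent [Fintype m] [Nonempty m] {P : Matrix m n Prop}
    {B : Matrix m n ℝ} (hB : ∀ i j, B i j ≠ 0 → P i j) {U : Finset n}
    (hU : LinearIndependent ℝ fun x : U => fun i => B i x) : Matchable P U := by
  classical
  refine matchable_of_card_le fun S hS => ?_
  -- `R` is the set of rows meeting `S`. The columns of `S` vanish elsewhere, so they stay
  -- independent after restriction to `R`, which gives `|S| ≤ |R|`.
  set R : Finset m := Finset.univ.filter fun i => ∃ x ∈ S, B i x ≠ 0 with hR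
  have hli : LinearIndependent ℝ fun x : S => fun i : R => B i x := by
    have hS' : LinearIndependent ℝ fun x : S => fun i => B i x :=
      hU.comp (fun x : S => (⟨x, hS x.2⟩ : U)) fun x y hxy =>
        Subtype.ext (congrArg (fun z : U => (z : n)) hxy)
    rw [Fintype.linearIndependent_iff] at hS' ⊢
    intro c hc
    refine hS' c (funext fun i => ?_)
    by_cases hi : i ∈ R
    · simpa using congrFun hc ⟨i, hi⟩
    · have : ∀ x : S, B i x = 0 := fun x => by
        by_contra hx
        exact hi (by simpa [hR] using ⟨x, x.2, hx⟩)
      simp [this]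
  have hcard := hli.fintype_card_le_finrank
  rw [Module.finrank_fintype_fun_eq_card, Fintype.card_coe, Fintype.card_coe] at hcard
  refine ⟨R, hcard, fun y hy => ?_⟩
  obtain ⟨x, hx, h⟩ := (Finset.mem_filter.1 hy).2
  exact ⟨x, hx, hB _ _ h⟩

variable [Fintype n]

theorem exists_matchable_card_eq_rank [Fintype m] [Nonempty m] {P : Matrix m n Prop} {B : Matrix m n ℝ}
    (hB : ∀ i j, B i j ≠ 0 → P i j) : ∃ U, Matchable P U ∧ U.card = B.rank := by
  classical
  obtain ⟨κ, a, ha, hspan, hli⟩ := exists_linearIndependent' ℝ B.col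
  have : Finite κ := Finite.of_injective a ha
  have := Fintype.ofFinite κ
  refine ⟨Finset.univ.map ⟨a, ha⟩, matchable_of_linearIndependent hB ?_, ?_⟩
  · let e : κ ≃ (Finset.univ.map ⟨a, ha⟩ : Finset n) :=
      Equiv.ofBijective (fun k => ⟨a k, by simp⟩) ⟨fun k l h => ha (congrArg Subtype.val h), by
        rintro ⟨x, hx⟩
        obtain ⟨k, -, rfl⟩ := Finset.mem_map.1 hx
        exact ⟨k, rfl⟩⟩
    exact (linearIndependent_equiv e).1 hli
  · rw [Matrix.rank_eq_finrank_span_cols, ← hspan, finrank_span_eq_card hli, Finset.card_map,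
      Finset.card_univ]

theorem Matchable.exists_rank_ge {P : Matrix m n Prop} {U : Finset n} (hU : Matchable P U) :
    ∃ B : Matrix m n ℝ, HasPattern P B ∧ U.card ≤ B.rank := by
  classical
  obtain ⟨f, hf, hP⟩ := hU
  -- Weight `|U| + 1` on matched entries against 1 on the others makes the square block on `U`
  -- strictly diagonally dominant.
  let B : Matrix m n ℝ := fun y x =>
    if P y x then if x ∈ U ∧ f x = y then (U.card + 1 : ℝ) else 1 else 0
  refine ⟨B, fun i j => ?_, ?_⟩
  · by_cases h : P i j
    · simp only [B, h, if_true, iff_true]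
      split_ifs
      · positivity
      · exact one_ne_zero
    · simp [B, h]
  · have hdet : (B.submatrix (fun x : U => f x) (fun x : U => (x : n))).det ≠ 0 := by
      refine det_ne_zero_of_sum_row_lt_diag fun k => ?_
      have hk : ‖B (f k) k‖ = U.card + 1 := by
        have h1 : B (f k) k = U.card + 1 := by simp [B, hP k k.2]
        rw [h1, Real.norm_of_nonneg (by positivity)]
      simp only [submatrix_apply, hk]
      calc ∑ j ∈ Finset.univ.erase k, ‖B (f k) j‖
          ≤ ∑ j ∈ Finset.univ.erase k, (1 : ℝ) := by
            refine Finset.sum_le_sum fun j hj => ?_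
            have hne : ¬ (f j = f k) := fun h =>
              (Finset.mem_erase.1 hj).1 (Subtype.ext (hf j.2 k.2 h))
            simp only [B, hne, and_false, if_false]
            split_ifs <;> simp
        _ ≤ U.card := by
            rw [Finset.sum_const, nsmul_eq_mul, mul_one]
            exact_mod_cast (Finset.card_le_univ _).trans (Fintype.card_coe U).le
        _ < U.card + 1 := lt_add_one _
    have := rank_of_det_ne_zero hdet
    rw [Fintype.card_coe] at this
    rw [← this]
    exact rank_submatrix_le _ _ _

theorem bddAbove_rank (P : Matrix m n Prop) :
    BddAbove {r | ∃ B : Matrix m n ℝ, HasPattern P B ∧ B.rank = r} :=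
  ⟨Fintype.card n, by
    rintro r ⟨B, -, rfl⟩
    exact B.rank_le_card_width⟩

theorem Matchable.card_le_sRank {P : Matrix m n Prop} {U : Finset n} (hU : Matchable P U) :
    U.card ≤ sRank P := by
  obtain ⟨B, hB, hr⟩ := hU.exists_rank_ge
  exact hr.trans (le_csSup (bddAbove_rank P) ⟨B, hB, rfl⟩)

theorem exists_matchable_card_eq_sRank [Fintype m] [Nonempty m] (P : Matrix m n Prop) :
    ∃ U, Matchable P U ∧ U.card = sRank P := by
  classical
  have hne : {r | ∃ B : Matrix m n ℝ, HasPattern P B ∧ B.rank = r}.Nonempty :=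
    ⟨_, fun i j => if P i j then 1 else 0, fun i j => by by_cases h : P i j <;> simp [h], rfl⟩
  obtain ⟨B, hB, hr⟩ := Nat.sSup_mem hne (bddAbove_rank P)
  obtain ⟨U, hU, hc⟩ := exists_matchable_card_eq_rank (fun i j h => (hB i j).1 h)
  exact ⟨U, hU, hc.trans hr⟩

end TermRank

/-! ## Alternating paths and the exchange property -/

theorem exists_exit_of_reflTransGen {α : Type*} {r : α → α → Prop} {a b : α}
    (h : Relation.ReflTransGen r a b) {S : α → Prop} (ha : S a) (hb : ¬ S b) :
    ∃ x x', S x ∧ ¬ S x' ∧ Relation.ReflTransGen r a x ∧ r x x' := by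
  induction h with
  | refl => exact absurd ha hb
  | @tail c d hac hcd ih =>
    by_cases hc : S c
    · exact ⟨c, d, hc, hb, hac, hcd⟩
    · exact ih hc

section Exchange

variable {m n : Type*}

/-- One step of an alternating path between columns: along an entry of `P` outside the matching
`f` of `I` and back along the matching (or no move at all). -/
def AltStep (P : Matrix m n Prop) (I : Finset n) (f : n → m) (x x' : n) : Prop :=
  x' ∈ I ∧ P (f x') x

variable [Fintype m] [Nonempty m]

/-- Augmenting paths through Hall's condition, without flipping a path. If `S` contains `v`, then
`f` already serves `S \ {v}` and one more row adjacent to `S` suffices: `y` if `x ∈ S`, otherwise a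
row through which the path from `v` to `x` leaves `S`. -/
theorem matchable_insert_of_reachable [DecidableEq n] {P : Matrix m n Prop} {I : Finset n}
    {f : n → m} (hf : Set.InjOn f I) (hP : ∀ x ∈ I, P (f x) x) {v x : n} {y : m} (hv : v ∉ I)
    (hx : Relation.ReflTransGen (AltStep P I f) v x) (hy : P y x) (hyI : ∀ z ∈ I, f z ≠ y) :
    Matchable P (insert v I) := by
  refine matchable_of_exists_injOn fun S hS => ?_
  have hSI : ∀ z ∈ S, z ≠ v → z ∈ I := fun z hz hzv =>
    (Finset.mem_insert.1 (hS hz)).resolve_left hzv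
  by_cases hvS : v ∈ S
  · obtain ⟨y', hy', x', hx'S, hx'⟩ : ∃ y', (∀ z ∈ S, z ≠ v → f z ≠ y') ∧ ∃ x' ∈ S, P y' x' := by
      by_cases hxS : x ∈ S
      · exact ⟨y, fun z hz hzv => hyI z (hSI z hz hzv), x, hxS, hy⟩
      · obtain ⟨a, b, ha, hb, -, hbI, hab⟩ :=
          exists_exit_of_reflTransGen hx (S := (· ∈ S)) hvS hxS
        exact ⟨f b, fun z hz hzv h => hb (hf (hSI z hz hzv) hbI h ▸ hz), a, ha, hab⟩
    refine ⟨Function.update f v y', ?_, fun z hz => ?_⟩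
    · intro a ha b hb hab
      by_cases hav : a = v <;> by_cases hbv : b = v
      · rw [hav, hbv]
      · subst hav
        rw [Function.update_self, Function.update_of_ne hbv] at hab
        exact absurd hab.symm (hy' b hb hbv)
      · subst hbv
        rw [Function.update_self, Function.update_of_ne hav] at hab
        exact absurd hab (hy' a ha hav)
      · rw [Function.update_of_ne hav, Function.update_of_ne hbv] at hab
        exact hf (hSI a ha hav) (hSI b hb hbv) hab
    · by_cases hzv : z = v
      · subst hzv
        exact ⟨x', hx'S, by rwa [Function.update_self]⟩
      · exact ⟨z, hz, by rw [Function.update_of_ne hzv]; exact hP z (hSI z hz hzv)⟩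
  · have hSI' : ∀ z ∈ S, z ∈ I := fun z hz => hSI z hz fun h => hvS (h ▸ hz)
    exact ⟨f, hf.mono fun z hz => hSI' z hz, fun z hz => ⟨z, hz, hP z (hSI' z hz)⟩⟩

/-- The matroid exchange axiom. Let `R` be the columns reachable from `J \ I`. Without an
augmentation, every row adjacent to `R` is matched by `f` to a column of `I ∩ R`, so `|J ∩ R| ≤ |I ∩
R|`; outside `R`, `J` is contained in `I`. -/
theorem Matchable.exists_insert [DecidableEq n] {P : Matrix m n Prop} {I J : Finset n}
    (hI : Matchable P I) (hJ : Matchable P J) (hIJ : I.card < J.card) :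
    ∃ x ∉ I, Matchable P (insert x I) := by
  classical
  by_contra! hcon
  obtain ⟨f, hf, hP⟩ := hI
  obtain ⟨g, hg, hgP⟩ := hJ
  let R : n → Prop := fun x => ∃ v ∈ J, v ∉ I ∧ Relation.ReflTransGen (AltStep P I f) v x
  have hR : ∀ x, R x → ∀ y, P y x → ∃ z ∈ I, R z ∧ f z = y := by
    rintro x ⟨v, hvJ, hvI, hvx⟩ y hy
    by_contra! h
    by_cases hyI : ∀ z ∈ I, f z ≠ y
    · exact hcon v hvI (matchable_insert_of_reachable hf hP hvI hvx hy hyI)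
    · push Not at hyI
      obtain ⟨z, hz, rfl⟩ := hyI
      exact h z hz ⟨v, hvJ, hvI, hvx.tail ⟨hz, hy⟩⟩ rfl
  have h1 : (J.filter R).card ≤ (I.filter R).card := by
    rw [← Finset.card_image_of_injOn (hg.mono (Finset.coe_subset.2 (Finset.filter_subset R J)))]
    refine (Finset.card_le_card fun y hy => ?_).trans (Finset.card_image_le (f := f))
    obtain ⟨x, hx, rfl⟩ := Finset.mem_image.1 hy
    obtain ⟨hxJ, hxR⟩ := Finset.mem_filter.1 hx
    obtain ⟨z, hz, hzR, hzx⟩ := hR x hxR _ (hgP x hxJ)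
    exact Finset.mem_image.2 ⟨z, Finset.mem_filter.2 ⟨hz, hzR⟩, hzx⟩
  have h2 : (J.filter fun x => ¬ R x).card ≤ (I.filter fun x => ¬ R x).card := by
    refine Finset.card_le_card fun x hx => ?_
    obtain ⟨hxJ, hxR⟩ := Finset.mem_filter.1 hx
    refine Finset.mem_filter.2 ⟨?_, hxR⟩
    by_contra hxI
    exact hxR ⟨x, hxJ, hxI, .refl⟩
  have h3 := Finset.card_filter_add_card_filter_not (s := I) R
  have h4 := Finset.card_filter_add_card_filter_not (s := J) R
  omega

theorem Matchable.exists_superset {P : Matrix m n Prop} {I J : Finset n}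
    (hI : Matchable P I) (hJ : Matchable P J) (hIJ : I.card ≤ J.card) :
    ∃ B, I ⊆ B ∧ Matchable P B ∧ B.card = J.card := by
  classical
  induction hk : J.card - I.card generalizing I with
  | zero => exact ⟨I, subset_rfl, hI, by omega⟩
  | succ k ih =>
    obtain ⟨x, hx, hxI⟩ := hI.exists_insert hJ (by omega)
    have hc := Finset.card_insert_of_notMem hx
    obtain ⟨B, hB, h⟩ := ih hxI (by omega) (by omega)
    exact ⟨B, (Finset.subset_insert _ _).trans hB, h⟩

end Exchange

/-! ## Maximum matchings and contractions -/

section Contractions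

variable {V : Type*} {G : Digraph V} {M : Finset (V × V)}

theorem self_mem_contractionOf (v : V) : v ∈ contractionOf G M v := Relation.ReflTransGen.refl

variable [DecidableEq V]

theorem IsMatching.card_image_fst (hM : IsMatching G M) : (M.image Prod.fst).card = M.card :=
  Finset.card_image_of_injOn hM.2.1

theorem mem_image_fst_iff {x : V} : x ∈ M.image Prod.fst ↔ x ∉ unmatched M := by
  simp [unmatched]

theorem IsMatching.exists_fun (hM : IsMatching G M) :
    ∃ f : V → V, (∀ x ∈ M.image Prod.fst, (x, f x) ∈ M) ∧
      Set.InjOn f (M.image Prod.fst : Finset V) ∧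
      ∀ x ∈ M.image Prod.fst, systemPattern G (f x) x := by
  have h : ∀ x : V, ∃ y, x ∈ M.image Prod.fst → (x, y) ∈ M := by
    intro x
    by_cases hx : x ∈ M.image Prod.fst
    · obtain ⟨⟨a, b⟩, he, rfl⟩ := Finset.mem_image.1 hx
      exact ⟨b, fun _ => he⟩
    · exact ⟨x, fun h => absurd h hx⟩
  choose f hf using h
  refine ⟨f, hf, fun x hx y hy hxy => ?_, fun x hx => hM.1 _ (hf x hx)⟩
  exact congrArg Prod.fst (hM.2.2 (hf x hx) (hf y hy) hxy)

theorem IsMatching.matchable (hM : IsMatching G M) :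
    Matchable (systemPattern G) (M.image Prod.fst) := by
  obtain ⟨f, -, h1, h2⟩ := hM.exists_fun
  exact ⟨f, h1, h2⟩

theorem IsMaxMatching.card_le (hM : IsMaxMatching G M) {U : Finset V}
    (hU : Matchable (systemPattern G) U) : U.card ≤ M.card := by
  obtain ⟨f, hf, hP⟩ := hU
  have hinj : Set.InjOn (fun x => (x, f x)) U := fun x _ y _ h => congrArg Prod.fst h
  have := hM.2 (U.image fun x => (x, f x)) ⟨?_, ?_, ?_⟩
  · rwa [Finset.card_image_of_injOn hinj] at this
  · intro e he
    obtain ⟨x, hx, rfl⟩ := Finset.mem_image.1 he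
    exact hP x hx
  · rintro e he e' he' h
    obtain ⟨x, hx, rfl⟩ := Finset.mem_image.1 (Finset.mem_coe.1 he)
    obtain ⟨x', hx', rfl⟩ := Finset.mem_image.1 (Finset.mem_coe.1 he')
    have : x = x' := h
    rw [this]
  · rintro e he e' he' h
    obtain ⟨x, hx, rfl⟩ := Finset.mem_image.1 (Finset.mem_coe.1 he)
    obtain ⟨x', hx', rfl⟩ := Finset.mem_image.1 (Finset.mem_coe.1 he')
    have : x = x' := hf hx hx' h
    rw [this]

/-- Two half-steps through `V⁻` merge into one step between states. `AltStep` also permits going out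
along a matching link, but such a step stays in place, so nothing new is reached. -/
theorem mem_contractionOf_iff (hM : IsMatching G M) {f : V → V}
    (hf : ∀ x ∈ M.image Prod.fst, (x, f x) ∈ M) {v x : V} :
    x ∈ contractionOf G M v ↔
      Relation.ReflTransGen (AltStep (systemPattern G) (M.image Prod.fst) f) v x := by
  constructor
  · intro h
    have key : ∀ w, Relation.ReflTransGen (AuxEdge G M) (Sum.inl v) w →
        (∀ x, w = Sum.inl x →
          Relation.ReflTransGen (AltStep (systemPattern G) (M.image Prod.fst) f) v x) ∧
        (∀ y, w = Sum.inr y → ∃ x,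
          Relation.ReflTransGen (AltStep (systemPattern G) (M.image Prod.fst) f) v x ∧
            G.Adj x y) := by
      intro w hw
      induction hw with
      | refl => exact ⟨fun x hx => Sum.inl_injective hx ▸ .refl, fun y hy => by simp at hy⟩
      | @tail b c _ hbc ih =>
        rcases b with b | b <;> rcases c with c | c
        · exact hbc.elim
        · refine ⟨fun x hx => by simp at hx, fun y hy => ?_⟩
          obtain rfl := Sum.inr_injective hy
          exact ⟨b, ih.1 b rfl, hbc.1⟩
        · refine ⟨fun x hx => ?_, fun y hy => by simp at hy⟩
          obtain rfl := Sum.inl_injective hx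
          have hbc' : (c, b) ∈ M := hbc
          obtain ⟨z, hz, hzb⟩ := ih.2 b rfl
          have hc : c ∈ M.image Prod.fst := Finset.mem_image.2 ⟨_, hbc', rfl⟩
          have hfc : f c = b := congrArg Prod.snd (hM.2.1 (hf c hc) hbc' rfl)
          exact hz.tail ⟨hc, by rw [hfc]; exact hzb⟩
        · exact hbc.elim
    exact (key _ h).1 x rfl
  · intro h
    induction h with
    | refl => exact Relation.ReflTransGen.refl
    | @tail b c _ hbc ih =>
      obtain ⟨hc, hbc⟩ := hbc
      by_cases hb : (b, f c) ∈ M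
      · have : b = c := congrArg Prod.fst (hM.2.2 hb (hf c hc) rfl)
        exact this ▸ ih
      · exact (Relation.ReflTransGen.tail ih
          (show AuxEdge G M (Sum.inl b) (Sum.inr (f c)) from ⟨hbc, hb⟩)).tail
          (show AuxEdge G M (Sum.inr (f c)) (Sum.inl c) from hf c hc)

/-- An alternating step ends at a tail of the matching, so the root is the only unmatched state of
its contraction. Distinct roots thus give distinct contractions. -/
theorem IsMatching.eq_of_mem_contractionOf (hM : IsMatching G M) {v x : V}
    (hx : x ∈ contractionOf G M v) (hxu : x ∈ unmatched M) : x = v := by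
  obtain ⟨f, hf, -⟩ := hM.exists_fun
  rw [mem_contractionOf_iff hM hf] at hx
  rcases Relation.ReflTransGen.cases_tail hx with h | ⟨b, -, hb⟩
  · exact h
  · exact absurd hxu (mem_image_fst_iff.1 hb.1)

theorem IsMatching.contractionOf_injOn (hM : IsMatching G M) :
    Set.InjOn (contractionOf G M) (unmatched M) := fun v hv _ _ h =>
  hM.eq_of_mem_contractionOf (h ▸ self_mem_contractionOf v) hv

/-- Every out-neighbor of a contraction is the head of a matching link whose tail is in that
contraction. -/
theorem IsMaxMatching.exists_tail [Fintype V] (hM : IsMaxMatching G M) {v x y : V}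
    (hv : v ∈ unmatched M) (hx : x ∈ contractionOf G M v) (hxy : G.Adj x y) :
    ∃ x' ∈ contractionOf G M v, (x', y) ∈ M := by
  have : Nonempty V := ⟨v⟩
  obtain ⟨f, hf, hinj, hP⟩ := hM.1.exists_fun
  rw [mem_contractionOf_iff hM.1 hf] at hx
  -- A head `y` not covered by the matching would complete an augmenting path from `v`.
  by_cases hy : ∀ z ∈ M.image Prod.fst, f z ≠ y
  · have hvI : v ∉ M.image Prod.fst := fun h => mem_image_fst_iff.1 h hv
    have h1 := hM.card_le (matchable_insert_of_reachable hinj hP hvI hx hxy hy)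
    rw [Finset.card_insert_of_notMem hvI, hM.1.card_image_fst] at h1
    omega
  · push Not at hy
    obtain ⟨z, hz, rfl⟩ := hy
    exact ⟨z, (mem_contractionOf_iff hM.1 hf).2 (hx.tail ⟨hz, hxy⟩), hf z hz⟩

/-- A matching of states to out-neighbors and measurements consists of a matching of `G` and of
measured states. -/
theorem Matchable.exists_of_fromRows {ι : Type*} {s : ι → V} {U : Finset V}
    (hU : Matchable (Matrix.fromRows (systemPattern G) (sensorPattern s)) U) :
    ∃ B ⊆ U, Matchable (systemPattern G) B ∧ ∀ x ∈ U \ B, ∃ i, s i = x := by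
  obtain ⟨f, hf, hP⟩ := hU
  refine ⟨U.filter fun x => (f x).isLeft, Finset.filter_subset _ _,
    ⟨fun x => (f x).elim id fun _ => x, ?_, ?_⟩, ?_⟩
  · intro x hx x' hx' h
    simp only [Finset.coe_filter, Set.mem_ofPred_eq, Sum.isLeft_iff] at hx hx'
    obtain ⟨hxU, y, hy⟩ := hx
    obtain ⟨hxU', y', hy'⟩ := hx'
    refine hf hxU hxU' ?_
    simp only [hy, hy', Sum.elim_inl, id] at h ⊢
    rw [h]
  · intro x hx
    simp only [Finset.mem_filter, Sum.isLeft_iff] at hx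
    obtain ⟨hxU, y, hy⟩ := hx
    have := hP x hxU
    rw [hy] at this
    change systemPattern G ((f x).elim id fun _ => x) x
    rw [hy]
    exact this
  · intro x hx
    simp only [Finset.mem_sdiff, Finset.mem_filter, not_and, Bool.not_eq_true,
      Sum.isLeft_eq_false, Sum.isRight_iff] at hx
    obtain ⟨i, hi⟩ := hx.2 hx.1
    have := hP x hx.1
    rw [hi] at this
    exact ⟨i, Eq.symm this⟩

variable [Fintype V]

theorem IsMatching.ncard_unmatched_add (hM : IsMatching G M) :
    (unmatched M).ncard + M.card = Fintype.card V := by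
  have h : unmatched M = ((M.image Prod.fst)ᶜ : Finset V) := by
    ext x
    rw [Finset.mem_coe, Finset.mem_compl, mem_image_fst_iff, not_not]
  rw [h, Set.ncard_coe_finset, Finset.card_compl, ← hM.card_image_fst]
  have := Finset.card_le_univ (M.image Prod.fst)
  omega

theorem IsMatching.ncard_contractions_add (hM : IsMatching G M) :
    (contractions G M).ncard + M.card = Fintype.card V := by
  rw [contractions, hM.contractionOf_injOn.ncard_image, hM.ncard_unmatched_add]

theorem IsMaxMatching.sRank_eq [Nonempty V] (hM : IsMaxMatching G M) :
    sRank (systemPattern G) = M.card := by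
  apply le_antisymm
  · obtain ⟨U, hU, hc⟩ := exists_matchable_card_eq_sRank (systemPattern G)
    exact hc ▸ hM.card_le hU
  · rw [← hM.1.card_image_fst]
    exact hM.1.matchable.card_le_sRank

/-- The measurements of `T` recover one rank each iff some maximum matching leaves `T`
unmatched. -/
theorem IsMaxMatching.recoversRank_iff [Nonempty V] (hM : IsMaxMatching G M) {T : Finset V} :
    RecoversRank G T ↔
      ∃ B, Matchable (systemPattern G) B ∧ B.card = M.card ∧ Disjoint B T := by
  classical
  rw [RecoversRank, hM.sRank_eq]
  set Q := Matrix.fromRows (systemPattern G) (sensorPattern fun t : T => (t : V))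
  have hle : ∀ {U : Finset V}, Matchable Q U → ∃ B ⊆ U, Matchable (systemPattern G) B ∧
      U \ B ⊆ T := by
    intro U hU
    obtain ⟨B, hBU, hB, h⟩ := hU.exists_of_fromRows
    refine ⟨B, hBU, hB, fun x hx => ?_⟩
    obtain ⟨t, rfl⟩ := h x hx
    exact t.2
  constructor
  · intro h
    obtain ⟨U, hU, hc⟩ := exists_matchable_card_eq_sRank Q
    obtain ⟨B, hBU, hB, hUT⟩ := hle hU
    have h1 := hM.card_le hB
    have h2 := Finset.card_le_card hUT
    have h3 := Finset.card_sdiff_add_card_eq_card hBU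
    -- Since `|U| = |M| + |T|`, both bounds `|B| ≤ |M|` and `|U \ B| ≤ |T|` are equalities.
    refine ⟨B, hB, by omega, ?_⟩
    rw [← Finset.eq_of_subset_of_card_le hUT (by omega)]
    exact Finset.disjoint_sdiff
  · rintro ⟨B, ⟨f, hf, hP⟩, hc, hd⟩
    apply le_antisymm
    · obtain ⟨U, hU, hc'⟩ := exists_matchable_card_eq_sRank Q
      obtain ⟨B', hBU, hB', hUT⟩ := hle hU
      have h1 := hM.card_le hB'
      have h2 := Finset.card_le_card hUT
      have h3 := Finset.card_sdiff_add_card_eq_card hBU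
      omega
    · rw [← hc, ← Finset.card_union_of_disjoint hd]
      refine Matchable.card_le_sRank
        ⟨fun x => if hx : x ∈ T then Sum.inr ⟨x, hx⟩ else Sum.inl (f x), ?_, ?_⟩
      · intro x hx x' hx' h
        by_cases hxT : x ∈ T <;> by_cases hxT' : x' ∈ T <;> simp [hxT, hxT'] at h
        · exact h
        · simp only [Finset.coe_union, Set.mem_union, Finset.mem_coe, hxT, hxT', or_false] at hx hx'
          exact hf hx hx' h
      · intro x hx
        by_cases hxT : x ∈ T
        · simp only [hxT, dif_pos]
          exact (rfl : x = x)
        · have hxB : x ∈ B := by simpa [hxT] using hx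
          simp only [hxT, dif_neg, not_false_iff]
          exact hP x hxB

/-- If the tails of a maximum matching are removed, the remaining states lie in distinct
contractions. -/
theorem IsMaxMatching.exists_distinct_contractions (hM : IsMaxMatching G M) {B : Finset V}
    (hB : Matchable (systemPattern G) B) (hc : B.card = M.card) :
    ∃ c : V → V, Set.InjOn c (Bᶜ : Finset V) ∧
      ∀ x ∈ Bᶜ, c x ∈ unmatched M ∧ x ∈ contractionOf G M (c x) := by
  classical
  by_cases hV : IsEmpty V
  · exact ⟨id, Set.injOn_id _, fun x => hV.elim x⟩
  rw [not_isEmpty_iff] at hV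
  suffices h : Matchable (fun v x => v ∈ unmatched M ∧ x ∈ contractionOf G M v) Bᶜ from h
  refine matchable_of_card_le fun S hS => ?_
  set D := (M.image Prod.fst)ᶜ with hD
  have hDu : ∀ v, v ∈ D ↔ v ∈ unmatched M := fun v => by
    rw [hD, Finset.mem_compl, mem_image_fst_iff, not_not]
  refine ⟨D.filter fun v => ∃ x ∈ S, x ∈ contractionOf G M v, ?_, fun v hv => ?_⟩
  swap
  · obtain ⟨hvD, x, hx, hxv⟩ := Finset.mem_filter.1 hv
    exact ⟨x, hx, (hDu v).1 hvD, hxv⟩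
  -- Hall's condition by complement: `E` is the set of roots whose contractions avoid `S`, and `Q`
  -- is the union of these contractions. Following `g` and returning along `M` injects `Q ∩ B` into
  -- `Q \ E`, whence `|E| ≤ |Q \ B|`. As `Q \ B` and `S` are disjoint in `Bᶜ`, and `|Bᶜ| = |D|`, at
  -- least `|S|` roots remain outside `E`.
  set E := D.filter fun v => ¬ ∃ x ∈ S, x ∈ contractionOf G M v with hE
  set Q := Finset.univ.filter fun x => ∃ v ∈ E, x ∈ contractionOf G M v with hQ
  obtain ⟨g, hg, hgP⟩ := hB
  have htail : ∀ x, ∃ x', x ∈ Q → x ∈ B → x' ∈ Q \ E ∧ (x', g x) ∈ M := by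
    intro x
    by_cases hx : x ∈ Q ∧ x ∈ B
    · obtain ⟨v, hv, hxv⟩ := (Finset.mem_filter.1 hx.1).2
      have hvD := (Finset.mem_filter.1 hv).1
      obtain ⟨x', hx', hm⟩ := hM.exists_tail ((hDu v).1 hvD) hxv (hgP x hx.2)
      refine ⟨x', fun _ _ => ⟨Finset.mem_sdiff.2
        ⟨Finset.mem_filter.2 ⟨Finset.mem_univ _, v, hv, hx'⟩, fun h => ?_⟩, hm⟩⟩
      exact (hDu x').1 (Finset.mem_filter.1 h).1 _ hm
    · exact ⟨x, fun h1 h2 => absurd ⟨h1, h2⟩ hx⟩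
  choose t ht using htail
  have h1 : (Q ∩ B).card ≤ (Q \ E).card := by
    refine Finset.card_le_card_of_injOn t (fun x hx => ?_) fun x hx y hy hxy => ?_
    · obtain ⟨h1, h2⟩ := Finset.mem_inter.1 hx
      exact (ht x h1 h2).1
    · obtain ⟨hx1, hx2⟩ := Finset.mem_inter.1 hx
      obtain ⟨hy1, hy2⟩ := Finset.mem_inter.1 hy
      refine hg hx2 hy2 (congrArg Prod.snd (hM.1.2.1 (ht x hx1 hx2).2 (ht y hy1 hy2).2 hxy))
  have hEQ : E ⊆ Q := fun v hv =>
    Finset.mem_filter.2 ⟨Finset.mem_univ _, v, hv, self_mem_contractionOf v⟩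
  have h2 := Finset.card_sdiff_add_card_eq_card hEQ
  have h3 := Finset.card_inter_add_card_sdiff Q B
  have h4 : (Q \ B).card + S.card ≤ (Bᶜ).card := by
    rw [← Finset.card_union_of_disjoint]
    · refine Finset.card_le_card (Finset.union_subset (fun x hx => ?_) hS)
      exact Finset.mem_compl.2 (Finset.mem_sdiff.1 hx).2
    · rw [Finset.disjoint_left]
      intro x hx hxS
      obtain ⟨v, hv, hxv⟩ := (Finset.mem_filter.1 (Finset.mem_sdiff.1 hx).1).2
      exact (Finset.mem_filter.1 hv).2 ⟨x, hxS, hxv⟩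
  have h5 := Finset.card_filter_add_card_filter_not (s := D)
    fun v => ∃ x ∈ S, x ∈ contractionOf G M v
  have h6 : D.card = Bᶜ.card := by
    rw [hD, Finset.card_compl, Finset.card_compl, hM.1.card_image_fst, hc]
  rw [← hE] at h5
  omega

/-- States in distinct, pairwise disjoint contractions are jointly unmatched in some maximum
matching. -/
theorem IsMaxMatching.exists_disjoint_of_pairwiseDisjoint [Nonempty V] (hM : IsMaxMatching G M)
    (hd : (contractions G M).PairwiseDisjoint id) {T : Finset V} {c : V → Set V}
    (hc : Set.InjOn c T) (hcT : ∀ x ∈ T, c x ∈ contractions G M ∧ x ∈ c x) :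
    ∃ B, Matchable (systemPattern G) B ∧ B.card = M.card ∧ Disjoint B T := by
  classical
  obtain ⟨f, hf, hinj, hP⟩ := hM.1.exists_fun
  set I := M.image Prod.fst with hI
  have hroot : ∀ x, ∃ v, x ∈ T → v ∈ unmatched M ∧ contractionOf G M v = c x := by
    intro x
    by_cases hx : x ∈ T
    · obtain ⟨v, hv, h⟩ := (hcT x hx).1
      exact ⟨v, fun _ => ⟨hv, h⟩⟩
    · exact ⟨x, fun h => absurd h hx⟩
  choose r hr using hroot
  have hrinj : Set.InjOn r T := fun x hx y hy hxy => hc hx hy (by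
    rw [← (hr x hx).2, ← (hr y hy).2, hxy])
  set D := T.image r with hD
  have hDu : ∀ v ∈ D, v ∈ unmatched M := by
    intro v hv
    obtain ⟨x, hx, rfl⟩ := Finset.mem_image.1 hv
    exact (hr x hx).1
  have hDI : Disjoint I D := Finset.disjoint_left.2 fun x hx hxD =>
    mem_image_fst_iff.1 hx (hDu x hxD)
  have hTsub : T ⊆ I ∪ D := by
    intro x hx
    by_cases hxI : x ∈ I
    · exact Finset.mem_union_left _ hxI
    · have hxu : x ∈ unmatched M := by
        by_contra h
        exact hxI (mem_image_fst_iff.2 h)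
      have hxr : x ∈ contractionOf G M (r x) := (hr x hx).2 ▸ (hcT x hx).2
      rw [hM.1.eq_of_mem_contractionOf hxr hxu]
      exact Finset.mem_union_right _ (Finset.mem_image_of_mem _ hx)
  refine ⟨(I ∪ D) \ T, matchable_of_exists_injOn fun S hS => ?_, ?_, Finset.sdiff_disjoint⟩
  -- For a root `v ∈ S`, the alternating path to its chosen state, which is not in `S`, leaves `S`
  -- at some `k`, and the row `f k` is adjacent to `S`. Using `f k` for `v` causes no collision: `k
  -- ∉ S`, and exits of different roots lie in disjoint contractions.
  · have hexit : ∀ v, ∃ k, v ∈ S → v ∉ I → k ∈ I ∧ k ∉ S ∧ k ∈ contractionOf G M v ∧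
        v ∈ unmatched M ∧ ∃ x ∈ S, G.Adj x (f k) := by
      intro v
      by_cases hv : v ∈ S ∧ v ∉ I
      · have hvD : v ∈ D :=
          (Finset.mem_union.1 (Finset.mem_sdiff.1 (hS hv.1)).1).resolve_left hv.2
        obtain ⟨t, ht, rfl⟩ := Finset.mem_image.1 hvD
        have htr : t ∈ contractionOf G M (r t) := (hr t ht).2 ▸ (hcT t ht).2
        have htS : t ∉ S := fun h => (Finset.mem_sdiff.1 (hS h)).2 ht
        obtain ⟨a, b, ha, hb, hva, hbI, hab⟩ := exists_exit_of_reflTransGen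
          ((mem_contractionOf_iff hM.1 hf).1 htr) (S := (· ∈ S)) hv.1 htS
        exact ⟨b, fun _ _ => ⟨hbI, hb, (mem_contractionOf_iff hM.1 hf).2 (hva.tail ⟨hbI, hab⟩),
          hDu _ hvD, a, ha, hab⟩⟩
      · exact ⟨v, fun h1 h2 => absurd ⟨h1, h2⟩ hv⟩
    choose k hk using hexit
    set κ : V → V := fun x => if x ∈ I then x else k x with hκ
    have hκI : ∀ x ∈ S, κ x ∈ I := by
      intro x hx
      by_cases hxI : x ∈ I
      · simp [hκ, hxI]
      · simpa only [hκ, hxI, if_false] using (hk x hx hxI).1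
    have hκinj : Set.InjOn κ S := by
      intro x hx y hy hxy
      by_cases hxI : x ∈ I <;> by_cases hyI : y ∈ I <;>
        simp only [hκ, hxI, hyI, if_true, if_false] at hxy
      · exact hxy
      · exact absurd (hxy ▸ hx) (hk y hy hyI).2.1
      · exact absurd (hxy ▸ hy) (hk x hx hxI).2.1
      · obtain ⟨-, -, hkx, hxu, -⟩ := hk x hx hxI
        obtain ⟨-, -, hky, hyu, -⟩ := hk y hy hyI
        refine hM.1.contractionOf_injOn hxu hyu ?_
        by_contra hne
        exact Set.disjoint_left.1 (hd ⟨x, hxu, rfl⟩ ⟨y, hyu, rfl⟩ hne) hkx (hxy ▸ hky)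
    refine ⟨fun x => f (κ x), fun x hx y hy hxy =>
      hκinj hx hy (hinj (hκI x hx) (hκI y hy) hxy), fun x hx => ?_⟩
    by_cases hxI : x ∈ I
    · exact ⟨x, hx, by simpa only [hκ, hxI, if_true] using hP x hxI⟩
    · obtain ⟨-, -, -, -, z, hz, hzk⟩ := hk x hx hxI
      refine ⟨z, hz, ?_⟩
      simp only [hκ, hxI, if_false]
      exact hzk
  · have h1 := Finset.card_sdiff_add_card_eq_card hTsub
    rw [Finset.card_union_of_disjoint hDI, hD, Finset.card_image_of_injOn hrinj,
      hI, hM.1.card_image_fst] at h1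
    rw [hI, hD]
    omega

end Contractions

/-! ## Parent components -/

section Components

variable {V : Type*} {G : Digraph V}

theorem self_mem_sccOf (x : V) : x ∈ sccOf G x := ⟨.refl, .refl⟩

theorem sccOf_eq_of_mem {x y : V} (h : y ∈ sccOf G x) : sccOf G y = sccOf G x := by
  ext z
  exact ⟨fun hz => ⟨h.1.trans hz.1, hz.2.trans h.2⟩, fun hz => ⟨h.2.trans hz.1, hz.2.trans h.1⟩⟩

theorem eq_sccOf_of_mem_parentSCCs {S : Set V} (hS : S ∈ parentSCCs G) {x : V} (hx : x ∈ S) :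
    S = sccOf G x := by
  obtain ⟨⟨y, rfl⟩, -⟩ := hS
  exact (sccOf_eq_of_mem hx).symm

theorem mem_of_mem_parentSCCs_of_reachable {S : Set V} (hS : S ∈ parentSCCs G) {x y : V}
    (hx : x ∈ S) (h : Relation.ReflTransGen G.Adj x y) : y ∈ S := by
  induction h with
  | refl => exact hx
  | tail _ hbc ih => exact hS.2 _ ih _ hbc

/-- Among the states reachable from `x`, one with the smallest set of reachable states works:
anything it reaches has the same reachable set and hence leads back. -/
theorem exists_reachable_parentSCC [Finite V] (x : V) :
    ∃ y, Relation.ReflTransGen G.Adj x y ∧ sccOf G y ∈ parentSCCs G := by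
  let R : V → Set V := fun z => {w | Relation.ReflTransGen G.Adj z w}
  obtain ⟨y, hxy, hmin⟩ := Set.exists_min_image (R x) (fun z => (R z).ncard) (Set.toFinite _)
    ⟨x, Relation.ReflTransGen.refl⟩
  refine ⟨y, hxy, ⟨y, rfl⟩, fun u hu w huw => ?_⟩
  have hyw : Relation.ReflTransGen G.Adj y w := hu.1.tail huw
  refine ⟨hyw, ?_⟩
  have hsub : R w ⊆ R y := fun z hz => hyw.trans hz
  have heq := Set.eq_of_subset_of_ncard_le hsub (hmin w (hxy.trans hyw)) (Set.toFinite _)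
  exact (heq ▸ (Relation.ReflTransGen.refl : y ∈ R y) : y ∈ R w)

end Components

/-! ## Invariant subspaces and eigenvectors -/

section Eigen

variable {K E : Type*} [Field K] [IsAlgClosed K] [AddCommGroup E] [Module K E]
  [FiniteDimensional K E]

theorem exists_eigenvector_mem {T : E →ₗ[K] E} {U : Submodule K E} (hU : ∀ u ∈ U, T u ∈ U)
    {e : E} (he : e ∈ U) (he0 : e ≠ 0) : ∃ μ : K, ∃ v ∈ U, v ≠ 0 ∧ T v = μ • v := by
  have : Nontrivial U := ⟨⟨⟨e, he⟩, 0, fun h => he0 (congrArg Subtype.val h)⟩⟩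
  obtain ⟨μ, hμ⟩ := Module.End.exists_eigenvalue (T.restrict hU)
  obtain ⟨v, hv⟩ := hμ.exists_hasEigenvector
  exact ⟨μ, v, v.2, fun h => hv.2 (Subtype.ext h), congrArg Subtype.val hv.apply_eq_smul⟩

/-- If no eigenvector of `T` lies in the subspace `U₀`, then a nonzero vector `e` has a resolvent
value in `U₀` at finitely many points only. -/
theorem finite_resolvent_mem {T : E →ₗ[K] E} {U₀ : Submodule K E}
    (hT : ∀ μ : K, ∀ v ∈ U₀, T v = μ • v → v = 0) {e : E} (he : e ≠ 0) :
    {μ : K | ∃ u ∈ U₀, μ • u - T u = e}.Finite := by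
  by_contra hinf
  obtain ⟨t, ht, hcard⟩ := Set.Infinite.exists_subset_card_eq hinf (Module.finrank K E + 1)
  let l : Fin (Module.finrank K E + 1) → K := fun i => (t.equivFinOfCardEq hcard).symm i
  have hl : Function.Injective l :=
    Subtype.val_injective.comp (t.equivFinOfCardEq hcard).symm.injective
  have hlt : ∀ i, ∃ u ∈ U₀, l i • u - T u = e := fun i =>
    ht ((t.equivFinOfCardEq hcard).symm i).2
  choose u hu hue using hlt
  have hTu : ∀ i, T (u i) = l i • u i - e := fun i => by rw [← hue i]; abel
  -- If `e` were in the span of the `u i`, that span would be `T`-invariant and inside `U₀`, hence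
  -- would contain a forbidden eigenvector.
  have heU : e ∉ Submodule.span K (Set.range u) := by
    intro heU
    obtain ⟨μ, v, hv, hv0, hTv⟩ := exists_eigenvector_mem (T := T) (fun w hw => by
      induction hw using Submodule.span_induction with
      | mem w hw =>
        obtain ⟨i, rfl⟩ := hw
        rw [hTu]
        exact Submodule.sub_mem _
          (Submodule.smul_mem _ _ (Submodule.subset_span ⟨i, rfl⟩)) heU
      | zero => simp
      | add a b _ _ ha hb => rw [map_add]; exact Submodule.add_mem _ ha hb
      | smul c a _ ha => rw [map_smul]; exact Submodule.smul_mem _ _ ha) heU he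
    refine hv0 (hT μ v (Submodule.span_le.2 ?_ hv) hTv)
    rintro _ ⟨i, rfl⟩
    exact hu i
  have hdep : ¬ LinearIndependent K u := fun h => by
    have := h.fintype_card_le_finrank
    simp at this
  obtain ⟨a, ha, i, hi⟩ := Fintype.not_linearIndependent_iff.1 hdep
  -- Applying `T` to a relation among the `u i` produces a multiple of `e`, which must be zero. So
  -- each relation has coefficient sum zero and stays a relation after multiplication by `l i`.
  -- Iterating, all moments of `a` vanish, and Vandermonde gives `a = 0`.
  have hstep : ∀ b : Fin (Module.finrank K E + 1) → K, ∑ i, b i • u i = 0 →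
      ∑ i, b i = 0 ∧ ∑ i, (b i * l i) • u i = 0 := by
    intro b hb
    have h1 : ∑ i, (b i * l i) • u i = (∑ i, b i) • e := by
      have := congrArg T hb
      rw [map_sum, map_zero] at this
      simp only [map_smul, hTu, smul_sub, smul_smul, Finset.sum_sub_distrib,
        ← Finset.sum_smul] at this
      exact sub_eq_zero.1 this
    have h2 : ∑ i, b i = 0 := by
      by_contra hne
      refine heU ((Submodule.smul_mem_iff _ hne).1 (h1 ▸ ?_))
      exact Submodule.sum_mem _ fun i _ =>
        Submodule.smul_mem _ _ (Submodule.subset_span ⟨i, rfl⟩)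
    exact ⟨h2, by rw [h1, h2, zero_smul]⟩
  have hpow : ∀ k : ℕ, ∑ i, (a i * l i ^ k) • u i = 0 := by
    intro k
    induction k with
    | zero => simpa using ha
    | succ k ih => simpa only [pow_succ, mul_assoc] using (hstep _ ih).2
  exact hi (congrFun (eq_zero_of_forall_pow_sum_mul_pow_eq_zero hl
    fun j => (hstep _ (hpow j)).1) i)

end Eigen

/-! ## Sufficiency of the structural conditions -/

section Realization

variable {V ι : Type*} [Fintype V]

/-- No eigenvector of `A` that is supported on `S` vanishes at all the measured states. -/
def EigenObservable (s : ι → V) (S : Set V) (A : Matrix V V ℝ) : Prop :=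
  ∀ (μ : ℂ) (u : V → ℂ), (∀ x ∉ S, u x = 0) → A.map Complex.ofReal *ᵥ u = μ • u →
    (∀ i, u (s i) = 0) → u = 0

/-- The eigenvector test: the complexified unobservable subspace is invariant, so if nonzero it
contains an eigenvector invisible to the sensors. -/
theorem EigenObservable.observable [DecidableEq V] {s : ι → V} {A : Matrix V V ℝ}
    (h : EigenObservable s Set.univ A) : Observable A (sensorMatrix s fun _ => 1) := by
  intro x hx
  set T : (V → ℂ) →ₗ[ℂ] V → ℂ := (A.map Complex.ofReal).mulVecLin with hT
  let U : Submodule ℂ (V → ℂ) :=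
    ⨅ (k : ℕ) (i : ι), LinearMap.ker ((LinearMap.proj (s i)).comp (T ^ k))
  have hU : ∀ u, u ∈ U ↔ ∀ k i, (T ^ k) u (s i) = 0 := by
    intro u
    simp [U]
  have hpow : ∀ k, (T ^ k) (fun v => (x v : ℂ)) = fun v => (((A ^ k) *ᵥ x) v : ℂ) := by
    intro k
    induction k with
    | zero => simp
    | succ k ih =>
      rw [pow_succ', Module.End.mul_apply, ih, pow_succ', ← mulVec_mulVec]
      funext v
      simp [hT, mulVec, dotProduct]
  by_contra hx0
  have hxU : (fun v => (x v : ℂ)) ∈ U := by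
    rw [hU]
    intro k i
    have := congrFun (hx k) i
    rw [← mulVec_mulVec] at this
    rw [hpow]
    have h0 : ((A ^ k) *ᵥ x) (s i) = 0 := by simpa [sensorMatrix, mulVec, dotProduct] using this
    simp [h0]
  obtain ⟨μ, v, hv, hv0, hTv⟩ := exists_eigenvector_mem (T := T) (U := U) (fun u hu => by
    rw [hU] at hu ⊢
    intro k i
    have := hu (k + 1) i
    rwa [pow_succ, Module.End.mul_apply] at this) hxU (fun h0 => hx0 (funext fun v => by
      simpa using congrFun h0 v))
  exact hv0 (h μ v (by simp) hTv fun i => by simpa using (hU v).1 hv 0 i)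

theorem EigenObservable.finite_resolvent {s : ι → V} {S : Set V} {A : Matrix V V ℝ}
    (h : EigenObservable s S A) {e : V → ℂ} (he : e ≠ 0) :
    {μ : ℂ | ∃ u : V → ℂ, ((∀ x ∉ S, u x = 0) ∧ ∀ i, u (s i) = 0) ∧
      μ • u - A.map Complex.ofReal *ᵥ u = e}.Finite := by
  let U : Submodule ℂ (V → ℂ) :=
    { carrier := {u | (∀ x ∉ S, u x = 0) ∧ ∀ i, u (s i) = 0}
      add_mem' := fun ha hb => ⟨fun x hx => by simp [ha.1 x hx, hb.1 x hx],
        fun i => by simp [ha.2 i, hb.2 i]⟩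
      zero_mem' := ⟨fun _ _ => rfl, fun _ => rfl⟩
      smul_mem' := fun c a ha => ⟨fun x hx => by simp [ha.1 x hx],
        fun i => by simp [ha.2 i]⟩ }
  exact finite_resolvent_mem (T := (A.map Complex.ofReal).mulVecLin) (U₀ := U)
    (fun μ v hv hT => h μ v hv.1 hT hv.2) he

/-- The states whose path along the matching `φ` ends at a measurement. -/
inductive EndsAtSensor (φ : V → V ⊕ ι) : V → Prop
  | sensor {x : V} {i : ι} (h : φ x = Sum.inr i) : EndsAtSensor φ x
  | step {x y : V} (h : φ x = Sum.inl y) (hy : EndsAtSensor φ y) : EndsAtSensor φ x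

omit [Fintype V] in
theorem endsAtSensor_iff_of_eq {φ : V → V ⊕ ι} {x y : V} (h : φ x = Sum.inl y) :
    EndsAtSensor φ x ↔ EndsAtSensor φ y := by
  refine ⟨fun hx => ?_, .step h⟩
  cases hx with
  | sensor h' => simp [h] at h'
  | step h' hy => exact Sum.inl_injective (h ▸ h') ▸ hy

/-- The set `S` is a union of paths and cycles of the matching `φ`, among them all paths ending
at a measurement, and carries an observable realization. -/
def Realizable (G : Digraph V) (s : ι → V) (φ : V → V ⊕ ι) (S : Set V) : Prop :=
  (∀ x, EndsAtSensor φ x → x ∈ S) ∧ (∀ x ∉ S, ∀ y, φ x = Sum.inl y → y ∉ S) ∧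
    ∃ A : Matrix V V ℝ, (∀ y x, A y x ≠ 0 → G.Adj x y ∧ x ∈ S ∧ y ∈ S) ∧ EigenObservable s S A

variable [DecidableEq V] {G : Digraph V} {s : ι → V} {φ : V → V ⊕ ι}

/-- Starting point of the construction: the shift along the paths ending at sensors. There `u x = μ
• u y` when `φ x = y`, so vanishing propagates backwards from the sensor. -/
theorem realizable_endsAtSensor (hφ : Function.Injective φ)
    (hadj : ∀ x y, φ x = Sum.inl y → G.Adj x y) (hs : ∀ x i, φ x = Sum.inr i → x = s i) :
    Realizable G s φ {x | EndsAtSensor φ x} := by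
  classical
  refine ⟨fun x hx => hx, fun x hx y hy h => hx ((endsAtSensor_iff_of_eq hy).2 h),
    Matrix.of fun y x => if φ x = Sum.inl y ∧ EndsAtSensor φ x then 1 else 0, fun y x h => ?_, ?_⟩
  · simp only [of_apply, ne_eq, ite_eq_right_iff, one_ne_zero, imp_false, not_not] at h
    exact ⟨hadj x y h.1, h.2, (endsAtSensor_iff_of_eq h.1).1 h.2⟩
  · intro μ u hu hA hsu
    funext x
    by_cases hx : EndsAtSensor φ x
    · induction hx with
      | @sensor x i h => exact hs x i h ▸ hsu i
      | @step x y h hy ih =>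
        have h1 := congrFun hA y
        have h2 : ∀ z, (φ z = Sum.inl y ∧ EndsAtSensor φ z) ↔ z = x := fun z =>
          ⟨fun hz => hφ (hz.1.trans h.symm), fun hz => hz ▸ ⟨h, .step h hy⟩⟩
        simp only [Pi.smul_apply, ih, Pi.zero_apply, smul_zero] at h1
        simpa [mulVec, dotProduct, h2, apply_ite Complex.ofReal] using h1
    · exact hu x hx

omit [Fintype V] [DecidableEq V] in
/-- A set whose complement is nonempty and contains only states from which a measurement can be
reached is either missing a measured state or entered by a link. -/
theorem exists_entering (hreach : ∀ x, ∃ i, Relation.ReflTransGen G.Adj x (s i)) {S : Set V}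
    (hS : S ≠ Set.univ) : ∃ x ∉ S, (∃ i, s i = x) ∨ ∃ g ∈ S, G.Adj x g := by
  obtain ⟨x, hx⟩ := (Set.ne_univ_iff_exists_notMem S).1 hS
  obtain ⟨i, hi⟩ := hreach x
  by_cases his : s i ∈ S
  · obtain ⟨a, b, ha, hb, -, hab⟩ :=
      exists_exit_of_reflTransGen hi (S := (· ∉ S)) hx (not_not.2 his)
    exact ⟨a, ha, Or.inr ⟨b, not_not.1 hb, hab⟩⟩
  · exact ⟨s i, his, Or.inl ⟨i, rfl⟩⟩

/-- Data for attaching a cycle through `x₀` to `S`: `w` is a link from `x₀` into `S` and `p` the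
gain along the cycle. On a cycle of length `c` with a nonzero mode, `μ ^ c = p ^ c`, so only `‖μ‖`
is controlled; `‖p‖` is therefore put beyond all of the finitely many bad moduli. A measured `x₀`
needs no link. -/
theorem exists_gain {S : Set V} {A : Matrix V V ℝ} (hA : EigenObservable s S A)
    {x₀ : V} (hx₀ : (∃ i, s i = x₀) ∨ ∃ g ∈ S, G.Adj x₀ g) :
    ∃ (w : V → ℝ) (p : ℝ), p ≠ 0 ∧ (∀ y, w y ≠ 0 → G.Adj x₀ y ∧ y ∈ S) ∧
      ((∃ i, s i = x₀) ∨ ∀ (μ : ℂ) (u : V → ℂ), (∀ x ∉ S, u x = 0) → (∀ i, u (s i) = 0) →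
        μ • u - A.map Complex.ofReal *ᵥ u = (fun v => (w v : ℂ)) → ‖μ‖ ≠ ‖p‖) := by
  rcases hx₀ with h | ⟨g, hg, hadj⟩
  · exact ⟨0, 1, one_ne_zero, by simp, Or.inl h⟩
  · have he : (fun v => ((Pi.single g 1 : V → ℝ) v : ℂ)) ≠ 0 := fun h => by
      simpa using congrFun h g
    obtain ⟨C, hC⟩ := ((hA.finite_resolvent he).image fun μ => ‖μ‖).bddAbove
    refine ⟨Pi.single g 1, |C| + 1, by positivity, fun y hy => ?_, Or.inr ?_⟩
    · have : y = g := by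
        by_contra hne
        exact hy (Pi.single_eq_of_ne hne 1)
      exact this ▸ ⟨hadj, hg⟩
    · intro μ u h1 h2 h3 h4
      have := hC ⟨μ, ⟨u, ⟨h1, h2⟩, h3⟩, rfl⟩
      simp only [h4] at this
      rw [Real.norm_of_nonneg (by positivity)] at this
      linarith [le_abs_self C]

/-- Outside `S` the matching permutes the states, so the entering state `x₀` lies on a cycle `Z`,
which is added with gain `p`. Let `u` be an unseen eigenvector and `v` its part on `S`. Then `(μ -
A) v = u x₀ • w`; by the choice of `p` this forces `u x₀ = 0`. Hence `u` vanishes around `Z`, and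
`v` is an unseen eigenvector of the old system, so zero. -/
theorem Realizable.exists_ssuperset (hφ : Function.Injective φ)
    (hadj : ∀ x y, φ x = Sum.inl y → G.Adj x y)
    (hreach : ∀ x, ∃ i, Relation.ReflTransGen G.Adj x (s i)) {S : Set V}
    (hS : Realizable G s φ S) (hne : S ≠ Set.univ) : ∃ S', S ⊂ S' ∧ Realizable G s φ S' := by
  classical
  obtain ⟨hends, hclosed, A, hAG, hA⟩ := hS
  obtain ⟨x₀, hx₀, hor⟩ := exists_entering hreach hne
  obtain ⟨w, p, hp, hw, hgain⟩ := exists_gain hA hor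
  let f : V → V := fun x => (φ x).elim id fun _ => x
  have hφf : ∀ x ∉ S, φ x = Sum.inl (f x) := by
    intro x hx
    cases h : φ x with
    | inl y => simp [f, h]
    | inr i => exact absurd (hends x (.sensor h)) hx
  have hfS : Set.MapsTo f Sᶜ Sᶜ := fun x hx => hclosed x hx _ (hφf x hx)
  have hfinj : Set.InjOn f Sᶜ := fun x hx y hy h =>
    hφ ((hφf x hx).trans (h ▸ (hφf y hy).symm))
  obtain ⟨c, hc0, hc⟩ : ∃ c, 0 < c ∧ f^[c] x₀ = x₀ := by
    obtain ⟨a, b, hab, h⟩ := Finite.exists_ne_map_eq_of_infinite fun k => f^[k] x₀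
    wlog hlt : a < b generalizing a b
    · exact this b a hab.symm h.symm (lt_of_le_of_ne (not_lt.1 hlt) hab.symm)
    refine ⟨b - a, Nat.sub_pos_of_lt hlt, ?_⟩
    refine hfinj.iterate hfS a (hfS.iterate _ hx₀) hx₀ ?_
    rw [← Function.iterate_add_apply, Nat.add_sub_cancel' hlt.le]
    exact h.symm
  let Z : Set V := {z | ∃ k, f^[k] x₀ = z}
  have hZS : ∀ z ∈ Z, z ∉ S := by
    rintro _ ⟨k, rfl⟩
    exact hfS.iterate k hx₀
  have hx₀Z : x₀ ∈ Z := ⟨0, rfl⟩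
  have hfZ : ∀ z ∈ Z, f z ∈ Z := by
    rintro _ ⟨k, rfl⟩
    exact ⟨k + 1, Function.iterate_succ_apply' f k x₀⟩
  have hZx₀ : ∀ z ∈ Z, ∃ j, f^[j] z = x₀ := by
    rintro _ ⟨k, rfl⟩
    refine ⟨c * k - k, ?_⟩
    rw [← Function.iterate_add_apply, Nat.sub_add_cancel (Nat.le_mul_of_pos_left k hc0)]
    rw [Function.iterate_mul]
    exact Function.iterate_fixed hc k
  have hfZ' : ∀ x ∉ S, f x ∈ Z → x ∈ Z := by
    rintro x hx ⟨k, hk⟩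
    -- One step before `k` on the cycle; adding the period `c > 0` covers `k = 0`.
    refine ⟨k + c - 1, hfinj (hfS.iterate _ hx₀) hx ?_⟩
    rw [← Function.iterate_succ_apply' f, Nat.succ_eq_add_one, Nat.sub_add_cancel (by omega),
      Function.iterate_add_apply, hc, hk]
  let A' : Matrix V V ℝ := Matrix.of fun y x =>
    A y x + (if x ∈ Z ∧ y = f x then p else 0) + if x = x₀ then w y else 0
  refine ⟨S ∪ Z, Set.ssubset_iff_of_subset Set.subset_union_left |>.2 ⟨x₀, Or.inr hx₀Z, hx₀⟩,
    fun x hx => Or.inl (hends x hx), fun x hx y hy => ?_, A', fun y x hyx => ?_, ?_⟩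
  · rw [Set.mem_union, not_or] at hx ⊢
    obtain rfl : f x = y := Sum.inl_injective ((hφf x hx.1).symm.trans hy)
    exact ⟨hfS hx.1, fun h => hx.2 (hfZ' x hx.1 h)⟩
  · by_cases h1 : A y x ≠ 0
    · exact ⟨(hAG y x h1).1, Or.inl (hAG y x h1).2.1, Or.inl (hAG y x h1).2.2⟩
    by_cases h2 : x ∈ Z ∧ y = f x
    · obtain ⟨hxZ, rfl⟩ := h2
      exact ⟨hadj _ _ (hφf x (hZS x hxZ)), Or.inr hxZ, Or.inr (hfZ x hxZ)⟩
    by_cases h3 : x = x₀ ∧ w y ≠ 0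
    · obtain ⟨rfl, h3⟩ := h3
      exact ⟨(hw y h3).1, Or.inr hx₀Z, Or.inl (hw y h3).2⟩
    refine absurd ?_ hyx
    rw [not_not] at h1
    simp only [A', of_apply, h1, h2, if_false, zero_add]
    split_ifs with h4
    · by_contra h5
      exact h3 ⟨h4, h5⟩
    · rfl
  · intro μ u hu hAu hsu
    have hmul : ∀ y, μ * u y = ∑ x, (A y x : ℂ) * u x +
        (∑ x, if x ∈ Z ∧ y = f x then p * u x else 0) + w y * u x₀ := by
      intro y
      have := congrFun hAu y
      simp only [Pi.smul_apply, smul_eq_mul] at this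
      rw [← this]
      simp [mulVec, dotProduct, A', add_mul, Finset.sum_add_distrib, apply_ite Complex.ofReal]
    have hcyc : ∀ z ∈ Z, μ * u (f z) = p * u z := by
      intro z hz
      have hfz := hZS _ (hfZ z hz)
      have h1 : ∀ x, A (f z) x = 0 := fun x => by
        by_contra h
        exact hfz (hAG _ _ h).2.2
      have h2 : w (f z) = 0 := by
        by_contra h
        exact hfz (hw _ h).2
      have h3 : ∀ x, (x ∈ Z ∧ f z = f x) ↔ x = z := fun x =>
        ⟨fun h => (hfinj (hZS z hz) (hZS x h.1) h.2).symm, fun h => by rw [h]; exact ⟨hz, rfl⟩⟩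
      rw [hmul]
      simp [h1, h2, h3]
    have hiter : ∀ k, ∀ z ∈ Z, μ ^ k * u (f^[k] z) = p ^ k * u z := by
      intro k
      induction k with
      | zero => simp
      | succ k ih =>
        intro z hz
        rw [Function.iterate_succ_apply, pow_succ', mul_assoc, ih _ (hfZ z hz), mul_left_comm,
          hcyc z hz, pow_succ]
        ring
    let v : V → ℂ := fun x => if x ∈ S then u x else 0
    have hv : ∀ x ∉ S, v x = 0 := fun x hx => by simp [v, hx]
    have hsv : ∀ i, v (s i) = 0 := fun i => by simp [v, hsu i]
    have hAv : ∀ y, ∑ x, (A y x : ℂ) * u x = (A.map Complex.ofReal *ᵥ v) y := by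
      intro y
      simp only [mulVec, dotProduct, map_apply]
      refine Finset.sum_congr rfl fun x _ => ?_
      by_cases hx : x ∈ S
      · simp [v, hx]
      · have : A y x = 0 := by
          by_contra h
          exact hx (hAG _ _ h).2.1
        simp [this]
    have hres : μ • v - A.map Complex.ofReal *ᵥ v = u x₀ • fun y => (w y : ℂ) := by
      funext y
      simp only [Pi.sub_apply, Pi.smul_apply, smul_eq_mul, ← hAv]
      by_cases hy : y ∈ S
      · have h1 : ∀ x, ¬ (x ∈ Z ∧ y = f x) := fun x h => hZS _ (hfZ x h.1) (h.2 ▸ hy)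
        have h2 := hmul y
        simp only [h1, if_false, Finset.sum_const_zero, add_zero] at h2
        simp only [v, hy, if_true, h2]
        ring
      · have h1 : ∀ x, A y x = 0 := fun x => by
          by_contra h
          exact hy (hAG _ _ h).2.2
        have h2 : w y = 0 := by
          by_contra h
          exact hy (hw _ h).2
        simp [v, hy, h1, h2]
    have hux₀ : u x₀ = 0 := by
      rcases hgain with ⟨i, rfl⟩ | hgain
      · exact hsu i
      · by_contra h0
        refine hgain μ ((u x₀)⁻¹ • v) (fun x hx => by simp [hv x hx]) (fun i => by simp [hsv i])
          ?_ ?_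
        · rw [mulVec_smul, smul_comm μ, ← smul_sub, hres, smul_smul, inv_mul_cancel₀ h0, one_smul]
        · have h1 := hiter c x₀ hx₀Z
          rw [hc] at h1
          have h2 : ‖μ‖ ^ c = ‖p‖ ^ c := by
            have := congrArg norm (mul_right_cancel₀ h0 h1)
            simpa using this
          exact (pow_left_inj₀ (norm_nonneg _) (norm_nonneg _) hc0.ne').1 h2
    have huZ : ∀ z ∈ Z, u z = 0 := by
      intro z hz
      obtain ⟨j, hj⟩ := hZx₀ z hz
      have h1 := hiter j z hz
      rw [hj, hux₀, mul_zero] at h1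
      exact (mul_eq_zero.1 h1.symm).resolve_left (pow_ne_zero _ (Complex.ofReal_ne_zero.2 hp))
    have hv0 : v = 0 := hA μ v hv (by
      rw [hux₀, zero_smul] at hres
      exact (sub_eq_zero.1 hres).symm) hsv
    funext x
    by_cases hxS : x ∈ S
    · simpa [v, hxS] using congrFun hv0 x
    · by_cases hxZ : x ∈ Z
      · exact huZ x hxZ
      · exact hu x (by simp [hxS, hxZ])

/-- If the states can be matched to distinct out-neighbors and measurements, and each of them
reaches a measured state, then some realization is observable. -/
theorem exists_observable_realization (hφ : Function.Injective φ)
    (hadj : ∀ x y, φ x = Sum.inl y → G.Adj x y) (hs : ∀ x i, φ x = Sum.inr i → x = s i)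
    (hreach : ∀ x, ∃ i, Relation.ReflTransGen G.Adj x (s i)) :
    ∃ A : Matrix V V ℝ, (∀ y x, A y x ≠ 0 → G.Adj x y) ∧
      Observable A (sensorMatrix s fun _ => 1) := by
  obtain ⟨S, hS⟩ := Set.Finite.exists_maximal (Set.toFinite {S | Realizable G s φ S})
    ⟨_, realizable_endsAtSensor hφ hadj hs⟩
  obtain rfl : S = Set.univ := by
    by_contra hne
    obtain ⟨S', hlt, hS'⟩ := Realizable.exists_ssuperset hφ hadj hreach hS.prop hne
    exact hS.not_gt hS' hlt
  obtain ⟨-, -, A, hA, hobs⟩ := hS.prop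
  exact ⟨A, fun y x h => (hA y x h).1, hobs.observable⟩

end Realization

/-! ## Almost all parameter values -/

section Generic

/-- A homogeneous analytic function that is nonzero somewhere is nonzero almost everywhere. -/
theorem ae_ne_zero_of_homogeneous {E : Type*} [NormedAddCommGroup E] [NormedSpace ℝ E]
    [FiniteDimensional ℝ E] [MeasurableSpace E] [BorelSpace E] (μ : Measure E)
    [μ.IsAddHaarMeasure] {F : E → ℝ} (hF : AnalyticOnNhd ℝ F Set.univ) {d : ℕ}
    (hhom : ∀ (t : ℝ) q, F (t • q) = t ^ d * F q) {q₀ : E} (h₀ : F q₀ ≠ 0) :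
    ∀ᵐ q ∂μ, F q ≠ 0 := by
  have hcont : Continuous F := continuous_iff_continuousAt.2 fun q =>
    (hF q (Set.mem_univ q)).continuousAt
  -- By Fubini it suffices to treat each line in direction `q₀`, where the zeros of a nonzero
  -- analytic function form a null set.
  refine ae_mem_of_ae_add_linearMap_mem (LinearMap.toSpanSingleton ℝ E q₀) volume μ
    (s := {q | F q ≠ 0}) (isOpen_ne.preimage hcont).measurableSet fun y => ?_
  have hline : AnalyticOnNhd ℝ (fun t : ℝ => F (y + t • q₀)) Set.univ := fun t _ =>
    (hF _ (Set.mem_univ _)).comp (f := fun t : ℝ => y + t • q₀)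
      (analyticAt_const.add (analyticAt_id.smul analyticAt_const))
  rcases hline.eqOn_zero_or_eventually_ne_zero_of_preconnected isPreconnected_univ with h | h
  · exfalso
    -- No line lies in the zero set: `F (t • y + q₀) = t ^ d * F (y + t⁻¹ • q₀)` tends to `F q₀ ≠ 0`
    -- as `t → 0`.
    have hlim : ContinuousAt (fun t : ℝ => F (t • y + q₀)) 0 := by fun_prop
    have hne := hlim.eventually_ne (by simpa using h₀ : F ((0 : ℝ) • y + q₀) ≠ 0)
    obtain ⟨t, ht, ht0⟩ := ((hne.filter_mono nhdsWithin_le_nhds).and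
      (self_mem_nhdsWithin : {0}ᶜ ∈ nhdsWithin (0 : ℝ) {0}ᶜ)).exists
    have h1 : F (y + t⁻¹ • q₀) = 0 := h (Set.mem_univ t⁻¹)
    have h2 := hhom t (y + t⁻¹ • q₀)
    rw [h1, mul_zero, smul_add, smul_smul, mul_inv_cancel₀ ht0, one_smul] at h2
    exact ht h2
  · have := ae_restrict_le_codiscreteWithin (μ := (volume : Measure ℝ)) MeasurableSet.univ h
    rw [Measure.restrict_univ] at this
    exact this

variable {V ι : Type*} [Fintype V] [DecidableEq V]

/-- An observable pair has a square nonsingular submatrix of its observability matrix. -/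
theorem Observable.exists_det_ne_zero {A : Matrix V V ℝ} {C : Matrix ι V ℝ}
    (h : Observable A C) : ∃ r : V → ℕ × ι,
      (Matrix.of fun v => (C * A ^ (r v).1) (r v).2).det ≠ 0 := by
  classical
  let row : ℕ × ι → V → ℝ := fun r => (C * A ^ r.1) r.2
  have hspan : Submodule.span ℝ (Set.range row) = ⊤ := by
    by_contra hne
    obtain ⟨g, hg0, hg⟩ := Submodule.exists_le_ker_of_lt_top _ (lt_top_iff_ne_top.2 hne)
    have hgx : ∀ w, g w = w ⬝ᵥ fun v => g (Pi.single v 1) := by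
      intro w
      conv_lhs => rw [pi_eq_sum_univ' w]
      simp [dotProduct, map_sum]
    have hx := h (fun v => g (Pi.single v 1)) fun k => funext fun i => by
      have : g (row (k, i)) = 0 := hg (Submodule.subset_span ⟨(k, i), rfl⟩)
      rw [hgx] at this
      exact this
    refine hg0 (LinearMap.ext fun w => ?_)
    rw [hgx, hx]
    simp
  obtain ⟨κ, a, ha, hsp, hli⟩ := exists_linearIndependent' ℝ row
  let b : Module.Basis κ ℝ (V → ℝ) := Module.Basis.mk hli (by rw [hsp, hspan])
  have : Fintype κ := FiniteDimensional.fintypeBasisIndex b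
  have hcard : Fintype.card V = Fintype.card κ := by
    rw [← Module.finrank_eq_card_basis b, Module.finrank_fintype_fun_eq_card]
  let e : V ≃ κ := Fintype.equivOfCardEq hcard
  refine ⟨fun v => a (e v), ?_⟩
  have hli' : LinearIndependent ℝ (Matrix.of fun v => row (a (e v))).row :=
    hli.comp e e.injective
  exact ((Matrix.isUnit_iff_isUnit_det _).1
    (Matrix.linearIndependent_rows_iff_isUnit.1 hli')).ne_zero

theorem observable_of_det_ne_zero {A : Matrix V V ℝ} {C : Matrix ι V ℝ} {r : V → ℕ × ι}
    (h : (Matrix.of fun v => (C * A ^ (r v).1) (r v).2).det ≠ 0) : Observable A C := by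
  intro x hx
  refine eq_zero_of_mulVec_eq_zero h (funext fun v => ?_)
  exact congrFun (hx (r v).1) (r v).2

variable {G : Digraph V} {s : ι → V}

omit [Fintype V] [DecidableEq V] in
theorem systemMatrix_smul (t : ℝ) (θ : V → V → ℝ) :
    systemMatrix G (t • θ) = t • systemMatrix G θ := by
  ext y x
  simp [systemMatrix]

omit [Fintype V] [DecidableEq V] in
theorem sensorMatrix_smul (t : ℝ) (h : ι → ℝ) : sensorMatrix s (t • h) = t • sensorMatrix s h := by
  ext y x
  simp [sensorMatrix]

theorem analyticAt_sensorMatrix_mul_pow [Fintype ι] (k : ℕ) (i : ι) (v : V)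
    (q : (V → V → ℝ) × (ι → ℝ)) :
    AnalyticAt ℝ (fun q : (V → V → ℝ) × (ι → ℝ) =>
      (sensorMatrix s q.2 * systemMatrix G q.1 ^ k) i v) q := by
  induction k generalizing v with
  | zero =>
    simp only [pow_zero, Matrix.mul_one, sensorMatrix, of_apply]
    split_ifs
    · exact ((ContinuousLinearMap.proj i).comp
        (ContinuousLinearMap.snd ℝ (V → V → ℝ) (ι → ℝ))).analyticAt q
    · exact analyticAt_const
  | succ k ih =>
    simp only [pow_succ, ← Matrix.mul_assoc]
    simp only [Matrix.mul_apply (N := systemMatrix G _)]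
    refine Finset.analyticAt_fun_sum _ fun x _ => (ih x).mul ?_
    simp only [systemMatrix, of_apply]
    split_ifs
    · exact ((ContinuousLinearMap.proj v).comp ((ContinuousLinearMap.proj x).comp
        (ContinuousLinearMap.fst ℝ (V → V → ℝ) (ι → ℝ)))).analyticAt q
    · exact analyticAt_const

omit [Fintype V] [DecidableEq V] in
theorem isAddHaarMeasure_volume_pi_pi {m n : Type*} [Fintype m] [Fintype n] :
    (volume : Measure (m → n → ℝ)).IsAddHaarMeasure :=
  have : (volume : Measure (n → ℝ)).IsAddHaarMeasure := inferInstance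
  Measure.pi.isAddHaarMeasure fun _ : m => (volume : Measure (n → ℝ))

/-- If some values of the parameters, zero being allowed, give an observable pair, then almost all
of them do. -/
theorem ae_observable [Fintype ι] {θ : V → V → ℝ} {h : ι → ℝ}
    (hobs : Observable (systemMatrix G θ) (sensorMatrix s h)) :
    ∀ᵐ q : (V → V → ℝ) × (ι → ℝ), Observable (systemMatrix G q.1) (sensorMatrix s q.2) := by
  obtain ⟨r, hr⟩ := hobs.exists_det_ne_zero
  let F : (V → V → ℝ) × (ι → ℝ) → ℝ := fun q =>
    (Matrix.of fun v => (sensorMatrix s q.2 * systemMatrix G q.1 ^ (r v).1) (r v).2).det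
  have hF : AnalyticOnNhd ℝ F Set.univ := fun q _ => by
    simp only [F, Matrix.det_apply, of_apply]
    refine Finset.analyticAt_fun_sum _ fun σ _ => ?_
    simp only [Units.smul_def, zsmul_eq_mul]
    exact analyticAt_const.mul (Finset.analyticAt_fun_prod _ fun v _ =>
      analyticAt_sensorMatrix_mul_pow _ _ _ q)
  -- A row of `C * A ^ k` has degree `k + 1` in the parameters.
  have hhom : ∀ (t : ℝ) q, F (t • q) = t ^ (∑ v, (1 + (r v).1)) * F q := by
    intro t q
    rw [← Finset.prod_pow_eq_pow_sum]
    simp only [F]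
    rw [← Matrix.det_mul_column]
    congr 1
    ext v x
    simp only [of_apply, Prod.smul_fst, Prod.smul_snd, systemMatrix_smul, sensorMatrix_smul,
      smul_pow, Matrix.smul_mul, Matrix.mul_smul, smul_smul, Matrix.smul_apply, smul_eq_mul, pow_add,
      pow_one]
    ring
  have h1 := isAddHaarMeasure_volume_pi_pi (m := V) (n := V)
  have h2 : (volume : Measure ((V → V → ℝ) × (ι → ℝ))).IsAddHaarMeasure :=
    Measure.prod.instIsAddHaarMeasure (volume : Measure (V → V → ℝ)) (volume : Measure (ι → ℝ))
  exact (ae_ne_zero_of_homogeneous volume hF hhom (q₀ := (θ, h)) hr).mono fun q hq =>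
    observable_of_det_ne_zero hq

end Generic

/-! ## Relations between the notions of observability -/

section Relations

variable {V : Type*} {N : ℕ} {G : Digraph V} {s : Fin N → V}

theorem hasPattern_systemMatrix {θ : V → V → ℝ} (hθ : ∀ y x, θ y x ≠ 0) :
    HasPattern (systemPattern G) (systemMatrix G θ) := by
  intro y x
  by_cases h : G.Adj x y <;> simp [systemMatrix, systemPattern, h, hθ]

theorem hasPattern_sensorMatrix {h : Fin N → ℝ} (hh : ∀ i, h i ≠ 0) :
    HasPattern (sensorPattern s) (sensorMatrix s h) := by
  intro i x
  by_cases hx : x = s i <;> simp [sensorMatrix, sensorPattern, hx, hh]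

variable [Fintype V]

theorem kronecker_mulVec_apply (W : Matrix (Fin N) (Fin N) ℝ) (A : Matrix V V ℝ)
    (x : Fin N × V → ℝ) (a : Fin N × V) :
    ((W ⊗ₖ A) *ᵥ x) a = ∑ j, W a.1 j * (A *ᵥ fun v => x (j, v)) a.2 := by
  simp [mulVec, dotProduct, Fintype.sum_prod_type, Finset.mul_sum, mul_assoc]

theorem localOutputs_mulVec_apply (H : Matrix (Fin N) V ℝ) (α : Fin N → Finset (Fin N))
    (x : Fin N × V → ℝ) (a : Fin N × V) :
    (localOutputs H α *ᵥ x) a = ∑ j ∈ α a.1, H j a.2 * (H *ᵥ fun v => x (a.1, v)) j := by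
  have h1 : ∀ b : Fin N × V, localOutputs H α a b * x b =
      if a.1 = b.1 then ∑ j ∈ α a.1, H j a.2 * H j b.2 * x b else 0 := by
    intro b
    simp only [localOutputs, of_apply, ite_mul, zero_mul, Matrix.sum_apply, vecMulVec_apply,
      Finset.sum_mul]
  change ∑ b, localOutputs H α a b * x b = _
  simp only [h1, Fintype.sum_prod_type]
  rw [Finset.sum_eq_single a.1 (fun i _ hi => by simp [Ne.symm hi]) (by simp)]
  simp only [if_true]
  rw [Finset.sum_comm]
  simp only [mulVec, dotProduct, Finset.mul_sum, mul_assoc]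

variable [DecidableEq V]

/-- States of `B` are matched along links, the others to their own measurements. The resulting
realization may vanish on some links, but it only serves as a seed for `ae_observable`. -/
theorem genericObservable_of_matchable {B : Finset V} (hB : Matchable (systemPattern G) B)
    (hs : ∀ x ∉ B, ∃ i, s i = x) (hreach : ∀ x, ∃ i, Relation.ReflTransGen G.Adj x (s i)) :
    GenericObservable G s := by
  classical
  obtain ⟨f, hf, hP⟩ := hB
  choose k hk using hs
  let φ : V → V ⊕ Fin N := fun x => if hx : x ∈ B then Sum.inl (f x) else Sum.inr (k x hx)
  have hφ : Function.Injective φ := by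
    intro x y hxy
    by_cases hx : x ∈ B <;> by_cases hy : y ∈ B <;>
      simp only [φ, hx, hy, dif_pos, dif_neg, not_false_iff, Sum.inl.injEq, Sum.inr.injEq,
        reduceCtorEq] at hxy
    · exact hf hx hy hxy
    · rw [← hk x hx, ← hk y hy, hxy]
  obtain ⟨A, hA, hobs⟩ := exists_observable_realization (G := G) (s := s) hφ
    (fun x y hxy => by
      by_cases hx : x ∈ B <;> simp only [φ, hx, dif_pos, dif_neg, not_false_iff, Sum.inl.injEq,
        reduceCtorEq] at hxy
      exact hxy ▸ hP x hx)
    (fun x i hxi => by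
      by_cases hx : x ∈ B <;> simp only [φ, hx, dif_pos, dif_neg, not_false_iff, Sum.inr.injEq,
        reduceCtorEq] at hxi
      rw [← hxi, hk x hx]) hreach
  have hAG : systemMatrix G A = A := by
    ext y x
    by_cases h : G.Adj x y
    · simp [systemMatrix, h]
    · have : A y x = 0 := by
        by_contra h0
        exact h (hA y x h0)
      simp [systemMatrix, h, this]
  exact ae_observable (θ := A) (h := fun _ => 1) (by rwa [hAG])

theorem isOpen_posVector (n : Type*) [Fintype n] :
    IsOpen (Set.univ.pi fun _ : n => Set.Ioi (0 : ℝ)) :=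
  isOpen_set_pi Set.finite_univ fun _ _ => isOpen_Ioi

theorem isOpen_posMatrix (m n : Type*) [Fintype m] [Fintype n] :
    IsOpen (Set.univ.pi fun _ : m => Set.univ.pi fun _ : n => Set.Ioi (0 : ℝ)) :=
  isOpen_set_pi Set.finite_univ fun _ _ => isOpen_posVector n

/-- A set of full measure is dense, so it meets the open set of positive parameters, where the zero
pattern is exact. -/
theorem GenericObservable.structObservable (h : GenericObservable G s) : StructObservable G s := by
  have h1 := isAddHaarMeasure_volume_pi_pi (m := V) (n := V)
  have h2 : (volume : Measure ((V → V → ℝ) × (Fin N → ℝ))).IsOpenPosMeasure :=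
    Measure.prod.instIsOpenPosMeasure (μ := (volume : Measure (V → V → ℝ)))
      (ν := (volume : Measure (Fin N → ℝ)))
  obtain ⟨q, hq, hobs⟩ := (Measure.dense_of_ae h).exists_mem_open
    ((isOpen_posMatrix V V).prod (isOpen_posVector (Fin N))) ⟨(1, 1), by simp⟩
  simp only [Set.mem_prod, Set.mem_pi, Set.mem_univ, true_imp_iff, Set.mem_Ioi] at hobs
  exact ⟨_, _, hasPattern_systemMatrix fun y x => (hobs.1 y x).ne',
    hasPattern_sensorMatrix fun i => (hobs.2 i).ne', hq⟩

/-- A vector killed by both `A` and `H` has zero output, so the columns of the stacked matrix are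
independent and can all be matched. -/
theorem StructObservable.exists_matchable (h : StructObservable G s) :
    ∃ B, Matchable (systemPattern G) B ∧ ∀ x ∉ B, ∃ i, s i = x := by
  obtain ⟨A, H, hA, hH, hobs⟩ := h
  by_cases hV : IsEmpty V
  · exact ⟨∅, ⟨id, by simp, by simp⟩, fun x => hV.elim x⟩
  rw [not_isEmpty_iff] at hV
  have hinj : Function.Injective (Matrix.fromRows A H).mulVec := by
    refine (injective_iff_map_eq_zero (Matrix.fromRows A H).mulVecLin).2 fun x hx => ?_
    have hx' : Sum.elim (A *ᵥ x) (H *ᵥ x) = 0 := by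
      rw [← fromRows_mulVec]
      exact hx
    have hAx : A *ᵥ x = 0 := funext fun y => congrFun hx' (Sum.inl y)
    have hHx : H *ᵥ x = 0 := funext fun i => congrFun hx' (Sum.inr i)
    refine hobs x fun k => ?_
    cases k with
    | zero => simpa using hHx
    | succ k => rw [pow_succ, ← Matrix.mul_assoc, ← mulVec_mulVec, hAx, mulVec_zero]
  have hU : Matchable (Matrix.fromRows (systemPattern G) (sensorPattern s)) Finset.univ := by
    refine matchable_of_linearIndependent (B := Matrix.fromRows A H) (fun i j hij => ?_)
      ((mulVec_injective_iff.1 hinj).comp _ Subtype.val_injective)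
    rcases i with y | i
    · exact (hA y j).1 hij
    · exact (hH i j).1 hij
  obtain ⟨B, -, hB, h⟩ := hU.exists_of_fromRows
  exact ⟨B, hB, fun x hx => h x (by simpa using hx)⟩

/-- The trajectory of the basis vector at `x` is supported on states reachable from `x`; if none is
measured, its output is zero. -/
theorem StructObservable.exists_reachable (h : StructObservable G s) (x : V) :
    ∃ i, Relation.ReflTransGen G.Adj x (s i) := by
  obtain ⟨A, H, hA, hH, hobs⟩ := h
  by_contra! hx
  have hpow : ∀ k z, (A ^ k *ᵥ Pi.single x 1) z ≠ 0 → Relation.ReflTransGen G.Adj x z := by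
    intro k
    induction k with
    | zero =>
      intro z hz
      have : z = x := by
        by_contra hne
        exact hz (by rw [pow_zero, one_mulVec, Pi.single_eq_of_ne hne])
      exact this ▸ .refl
    | succ k ih =>
      intro z hz
      rw [pow_succ', ← mulVec_mulVec] at hz
      obtain ⟨y, -, hy⟩ := Finset.exists_ne_zero_of_sum_ne_zero hz
      exact (ih y (right_ne_zero_of_mul hy)).tail ((hA z y).1 (left_ne_zero_of_mul hy))
  have h0 := hobs (Pi.single x 1) fun k => funext fun i => by
    rw [← mulVec_mulVec]
    refine Finset.sum_eq_zero fun z _ => ?_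
    by_contra hne
    have hz : z = s i := (hH i z).1 (left_ne_zero_of_mul hne)
    exact hx i (hz ▸ hpow k z (right_ne_zero_of_mul hne))
  simpa using congrFun h0 x

/-! ### Distributed observability -/

/-- Rows of `W` sum to one, so identical copies of `x` evolve as identical copies of `A ^ k *ᵥ x`.
An agent is needed to read off `x = 0`. -/
theorem StructDistObservable.structObservable {β α : Fin N → Finset (Fin N)} (hN : 0 < N)
    (h : StructDistObservable G s β α) : StructObservable G s := by
  obtain ⟨A, H, W, hA, hH, hW, hobs⟩ := h
  refine ⟨A, H, hA, hH, fun x hx => ?_⟩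
  have hpow : ∀ k, (W ⊗ₖ A) ^ k *ᵥ (fun a : Fin N × V => x a.2) = fun a => (A ^ k *ᵥ x) a.2 := by
    intro k
    induction k with
    | zero => simp
    | succ k ih =>
      rw [pow_succ', ← mulVec_mulVec, ih]
      funext a
      rw [kronecker_mulVec_apply, pow_succ', ← mulVec_mulVec]
      calc ∑ j, W a.1 j * (A *ᵥ fun v => (A ^ k *ᵥ x) v) a.2
          = ∑ j, W a.1 j * (A *ᵥ A ^ k *ᵥ x) a.2 := rfl
        _ = (A *ᵥ A ^ k *ᵥ x) a.2 := by rw [← Finset.sum_mul, hW.2.1, one_mul]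
  have h0 := hobs (fun a => x a.2) fun k => by
    rw [← mulVec_mulVec, hpow]
    funext a
    rw [localOutputs_mulVec_apply, mulVec_mulVec, hx k]
    simp
  exact funext fun v => congrFun h0 (⟨0, hN⟩, v)

theorem isStochasticOn_weightMatrix {β : Fin N → Finset (Fin N)} (hβ : IsNeighborhood β)
    {p : Fin N → Fin N → ℝ} (hp : ∀ i j, 0 < p i j) : IsStochasticOn β (weightMatrix β p) := by
  have hpos : ∀ i, 0 < ∑ k ∈ β i, p i k := fun i =>
    Finset.sum_pos (fun k _ => hp i k) ⟨i, hβ i⟩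
  refine ⟨fun i j => ?_, fun i => ?_, fun i j => ?_⟩
  · simp only [weightMatrix, of_apply]
    split_ifs
    · exact (div_pos (hp i j) (hpos i)).le
    · exact le_rfl
  · simp only [weightMatrix, of_apply]
    rw [Finset.sum_ite_mem, Finset.univ_inter, ← Finset.sum_div, div_self (hpos i).ne']
  · by_cases h : j ∈ β i <;> simp [weightMatrix, h, (hp i j).ne', (hpos i).ne']

theorem GenericDistObservable.structDistObservable {β α : Fin N → Finset (Fin N)}
    (hβ : IsNeighborhood β) (h : GenericDistObservable G s β α) :
    StructDistObservable G s β α := by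
  have h1 := isAddHaarMeasure_volume_pi_pi (m := V) (n := V)
  have h2 := isAddHaarMeasure_volume_pi_pi (m := Fin N) (n := Fin N)
  have h3 : (volume : Measure ((Fin N → ℝ) × (Fin N → Fin N → ℝ))).IsOpenPosMeasure :=
    Measure.prod.instIsOpenPosMeasure (μ := (volume : Measure (Fin N → ℝ)))
      (ν := (volume : Measure (Fin N → Fin N → ℝ)))
  have h4 : (volume : Measure ((V → V → ℝ) × (Fin N → ℝ) × (Fin N → Fin N → ℝ))).IsOpenPosMeasure :=
    Measure.prod.instIsOpenPosMeasure (μ := (volume : Measure (V → V → ℝ)))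
      (ν := (volume : Measure ((Fin N → ℝ) × (Fin N → Fin N → ℝ))))
  obtain ⟨q, hq, hobs⟩ := (Measure.dense_of_ae h).exists_mem_open
    ((isOpen_posMatrix V V).prod ((isOpen_posVector (Fin N)).prod
      (isOpen_posMatrix (Fin N) (Fin N)))) ⟨(1, 1, 1), by simp⟩
  simp only [Set.mem_prod, Set.mem_pi, Set.mem_univ, true_imp_iff, Set.mem_Ioi] at hobs
  exact ⟨_, _, _, hasPattern_systemMatrix fun y x => (hobs.1 y x).ne',
    hasPattern_sensorMatrix fun i => (hobs.2.1 i).ne', isStochasticOn_weightMatrix hβ hobs.2.2,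
    hq hobs.2.2⟩

/-- The system splits into `N` copies of `A` with output `Hᵀ H`, which has the same kernel as `H`.
-/
theorem Observable.one_kronecker {A : Matrix V V ℝ} {H : Matrix (Fin N) V ℝ}
    (h : Observable A H) :
    Observable ((1 : Matrix (Fin N) (Fin N) ℝ) ⊗ₖ A) (localOutputs H fun _ => Finset.univ) := by
  intro x hx
  have hpow : ∀ k, ((1 : Matrix (Fin N) (Fin N) ℝ) ⊗ₖ A) ^ k *ᵥ x =
      fun a : Fin N × V => (A ^ k *ᵥ fun v => x (a.1, v)) a.2 := by
    intro k
    induction k with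
    | zero => simp
    | succ k ih =>
      rw [pow_succ', ← mulVec_mulVec, ih]
      funext a
      rw [kronecker_mulVec_apply, pow_succ', ← mulVec_mulVec]
      simp [one_apply]
  funext a
  refine congrFun (h (fun v => x (a.1, v)) fun k => ?_) a.2
  rw [← mulVec_mulVec]
  set z := A ^ k *ᵥ fun v => x (a.1, v) with hz
  have hHz : Hᵀ *ᵥ (H *ᵥ z) = 0 := by
    funext v
    have := congrFun (hx k) (a.1, v)
    rw [← mulVec_mulVec, hpow, localOutputs_mulVec_apply] at this
    exact this
  have : (H *ᵥ z) ⬝ᵥ (H *ᵥ z) = 0 := by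
    rw [dotProduct_mulVec, ← mulVec_transpose, hHz, zero_dotProduct]
  exact dotProduct_self_eq_zero.1 this

theorem GenericObservable.genericDistObservable (h : GenericObservable G s) :
    GenericDistObservable G s (fun i => {i}) fun _ => Finset.univ := by
  have hq := (Measure.quasiMeasurePreserving_fst.comp
    (measurePreserving_prodAssoc (volume : Measure (V → V → ℝ)) (volume : Measure (Fin N → ℝ))
      (volume : Measure (Fin N → Fin N → ℝ))).symm.quasiMeasurePreserving).ae h
  filter_upwards [hq] with q hq hp
  have hW : weightMatrix (fun i => {i}) q.2.2 = 1 := by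
    ext i j
    by_cases hij : i = j
    · subst hij
      simp [weightMatrix, (hp i i).ne']
    · simp [weightMatrix, one_apply, hij, Ne.symm hij]
  rw [hW]
  exact Observable.one_kronecker hq

end Relations

/-! ## The minimum number of agents -/

section Count

variable {V : Type*} [Fintype V] {G : Digraph V} {M : Finset (V × V)}

theorem bddAbove_shared (G : Digraph V) (M : Finset (V × V)) :
    BddAbove {k | ∃ T : Finset V, IsSharedFamily G M T ∧ RecoversRank G T ∧ T.card = k} :=
  ⟨Fintype.card V, by
    rintro k ⟨T, -, -, rfl⟩
    exact T.card_le_univ⟩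

omit [Fintype V] in
theorem isSharedFamily_empty : IsSharedFamily G M ∅ :=
  ⟨⟨fun _ => ∅, by simp, by simp⟩, ⟨fun _ => ∅, by simp, by simp⟩⟩

variable [DecidableEq V] [Nonempty V]

theorem IsMaxMatching.exists_card_eq_sharedNumber (hM : IsMaxMatching G M) :
    ∃ T : Finset V, IsSharedFamily G M T ∧ RecoversRank G T ∧ T.card = sharedNumber G M := by
  have h0 : RecoversRank G ∅ := hM.recoversRank_iff.2
    ⟨_, hM.1.matchable, hM.1.card_image_fst, Finset.disjoint_empty_right _⟩
  exact Nat.sSup_mem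
    (s := {k | ∃ T : Finset V, IsSharedFamily G M T ∧ RecoversRank G T ∧ T.card = k})
    ⟨0, ∅, isSharedFamily_empty, h0, rfl⟩ (bddAbove_shared G M)

theorem IsMaxMatching.sharedNumber_eq_sharedPairNumber (hM : IsMaxMatching G M)
    (hd : (contractions G M).PairwiseDisjoint id) :
    sharedNumber G M = sharedPairNumber G M := by
  have : ∀ T : Finset V, IsSharedFamily G M T → RecoversRank G T := by
    rintro T ⟨⟨c, hc, hcT⟩, -⟩
    exact hM.recoversRank_iff.2 (hM.exists_disjoint_of_pairwiseDisjoint hd hc hcT)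
  unfold sharedNumber sharedPairNumber
  congr 1
  ext k
  exact ⟨fun ⟨T, h1, _, h3⟩ => ⟨T, h1, h3⟩, fun ⟨T, h1, h3⟩ => ⟨T, h1, this T h1, h3⟩⟩

/-- Any structurally observable choice of states uses at least
`|𝒞| + |𝒮ᵖ| - |𝒮ᵖ ∩ 𝒞|` agents. -/
theorem IsMaxMatching.le_add_sharedNumber (hM : IsMaxMatching G M) {N : ℕ} {s : Fin N → V}
    (hs : StructObservable G s) :
    (contractions G M).ncard + (parentSCCs G).ncard ≤ N + sharedNumber G M := by
  classical
  obtain ⟨B₀, hB₀, hsB₀⟩ := hs.exists_matchable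
  -- Enlarging the matched set to a base keeps every state outside it measured.
  obtain ⟨B, hBB, hB, hBc⟩ := hB₀.exists_superset hM.1.matchable
    (hM.1.card_image_fst ▸ hM.card_le hB₀)
  rw [hM.1.card_image_fst] at hBc
  have hrep : ∀ S : parentSCCs G, ∃ i, s i ∈ (S : Set V) := by
    rintro ⟨S, hS⟩
    obtain ⟨x, rfl⟩ := hS.1
    obtain ⟨i, hi⟩ := hs.exists_reachable x
    exact ⟨i, mem_of_mem_parentSCCs_of_reachable hS (self_mem_sccOf x) hi⟩
  choose k hk using hrep
  have : Fintype (parentSCCs G) := Fintype.ofFinite _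
  have hkinj : Function.Injective fun S => s (k S) := fun S S' h => Subtype.ext <| by
    rw [eq_sccOf_of_mem_parentSCCs S.2 (hk S), eq_sccOf_of_mem_parentSCCs S'.2 (hk S')]
    exact congrArg _ h
  set T₂ := Finset.univ.image fun S : parentSCCs G => s (k S) with hT₂
  have hT₂c : T₂.card = (parentSCCs G).ncard := by
    rw [hT₂, Finset.card_image_of_injective _ hkinj, Finset.card_univ, ← Nat.card_eq_fintype_card,
      Nat.card_coe_set_eq]
  have hT₁c : Bᶜ.card = (contractions G M).ncard := by
    have h1 := hM.1.ncard_contractions_add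
    have h2 := B.card_compl_add_card
    omega
  have hshared : (Bᶜ ∩ T₂).card ≤ sharedNumber G M := by
    refine le_csSup (bddAbove_shared G M) ⟨Bᶜ ∩ T₂, ⟨?_, ?_⟩, ?_, rfl⟩
    · obtain ⟨c, hc, hcB⟩ := hM.exists_distinct_contractions hB hBc
      refine ⟨fun x => contractionOf G M (c x), fun x hx y hy hxy => ?_, fun x hx => ?_⟩
      · have hx' := (Finset.mem_inter.1 hx).1
        have hy' := (Finset.mem_inter.1 hy).1
        exact hc hx' hy' (hM.1.contractionOf_injOn (hcB x hx').1 (hcB y hy').1 hxy)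
      · have hx' := (Finset.mem_inter.1 hx).1
        exact ⟨⟨c x, (hcB x hx').1, rfl⟩, (hcB x hx').2⟩
    · have hscc : ∀ S : parentSCCs G, sccOf G (s (k S)) = S := fun S =>
        (eq_sccOf_of_mem_parentSCCs S.2 (hk S)).symm
      refine ⟨sccOf G, fun x hx y hy hxy => ?_, fun x hx => ?_⟩
      · obtain ⟨S, -, rfl⟩ := Finset.mem_image.1 (Finset.mem_inter.1 hx).2
        obtain ⟨S', -, rfl⟩ := Finset.mem_image.1 (Finset.mem_inter.1 hy).2
        rw [hscc, hscc] at hxy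
        rw [Subtype.ext hxy]
      · obtain ⟨S, -, rfl⟩ := Finset.mem_image.1 (Finset.mem_inter.1 hx).2
        exact ⟨(hscc S).symm ▸ S.2, self_mem_sccOf _⟩
    · exact hM.recoversRank_iff.2 ⟨B, hB, hBc,
        disjoint_compl_right.mono_right Finset.inter_subset_left⟩
  have hN : (Bᶜ ∪ T₂).card ≤ N := by
    rw [← Fintype.card_fin N, ← Finset.card_univ]
    refine (Finset.card_le_card fun x hx => ?_).trans (Finset.card_image_le (f := s))
    rcases Finset.mem_union.1 hx with hx | hx
    · obtain ⟨i, rfl⟩ := hsB₀ x fun h => Finset.mem_compl.1 hx (hBB h)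
      exact Finset.mem_image_of_mem _ (Finset.mem_univ _)
    · obtain ⟨S, -, rfl⟩ := Finset.mem_image.1 hx
      exact Finset.mem_image_of_mem _ (Finset.mem_univ _)
  have := Finset.card_union_add_card_inter Bᶜ T₂
  omega

/-- Measuring a cobase of the matching matroid and one state of each parent component, with
maximum overlap, is generically observable. -/
theorem IsMaxMatching.exists_genericObservable (hM : IsMaxMatching G M) {N : ℕ}
    (hN : (contractions G M).ncard + (parentSCCs G).ncard = N + sharedNumber G M) :
    ∃ s : Fin N → V, GenericObservable G s := by
  classical
  obtain ⟨T, ⟨-, S, hSinj, hST⟩, hrank, hTc⟩ := hM.exists_card_eq_sharedNumber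
  obtain ⟨B, hB, hBc, hBT⟩ := hM.recoversRank_iff.1 hrank
  have : Fintype (parentSCCs G) := Fintype.ofFinite _
  -- The representative of a parent SCC is its element of `T` when there is one, which is unique;
  -- this forces the overlap with `Bᶜ` to contain `T`.
  have hrep : ∀ P : parentSCCs G, ∃ x ∈ (P : Set V), ∀ t ∈ T, t ∈ (P : Set V) → x = t := by
    rintro ⟨P, hP⟩
    by_cases h : ∃ t ∈ T, t ∈ P
    · obtain ⟨t, ht, htP⟩ := h
      refine ⟨t, htP, fun t' ht' htP' => hSinj ht ht' ?_⟩
      rw [eq_sccOf_of_mem_parentSCCs (hST t ht).1 (hST t ht).2,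
        eq_sccOf_of_mem_parentSCCs (hST t' ht').1 (hST t' ht').2,
        ← eq_sccOf_of_mem_parentSCCs hP htP, ← eq_sccOf_of_mem_parentSCCs hP htP']
    · push Not at h
      obtain ⟨x, rfl⟩ := hP.1
      exact ⟨x, self_mem_sccOf x, fun t ht htP => absurd htP (h t ht)⟩
  choose r hr hrT using hrep
  set T₂ := Finset.univ.image r with hT₂
  have hT₂c : T₂.card ≤ (parentSCCs G).ncard := by
    rw [← Nat.card_coe_set_eq, Nat.card_eq_fintype_card, ← Finset.card_univ]
    exact Finset.card_image_le
  have hT₁c : Bᶜ.card = (contractions G M).ncard := by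
    have h1 := hM.1.ncard_contractions_add
    have h2 := B.card_compl_add_card
    omega
  have hT : T ⊆ Bᶜ ∩ T₂ := by
    intro t ht
    refine Finset.mem_inter.2 ⟨Finset.mem_compl.2 (Finset.disjoint_right.1 hBT ht), ?_⟩
    exact Finset.mem_image.2
      ⟨⟨S t, (hST t ht).1⟩, Finset.mem_univ _, hrT _ t ht (hST t ht).2⟩
  have hcard := Finset.card_union_add_card_inter Bᶜ T₂
  have hle := Finset.card_le_card hT
  have hT₂ne : T₂.Nonempty := by
    obtain ⟨y, -, hy⟩ := exists_reachable_parentSCC (G := G) (Classical.arbitrary V)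
    exact ⟨_, Finset.mem_image_of_mem r (Finset.mem_univ ⟨_, hy⟩)⟩
  have hK : (Bᶜ ∪ T₂).card ≤ Fintype.card (Fin N) := by
    rw [Fintype.card_fin]
    omega
  obtain ⟨x₁, hx₁⟩ := hT₂ne
  have : Nonempty (Bᶜ ∪ T₂ : Finset V) := ⟨⟨x₁, Finset.mem_union_right _ hx₁⟩⟩
  obtain ⟨e⟩ : Nonempty ((Bᶜ ∪ T₂ : Finset V) ↪ Fin N) :=
    Function.Embedding.nonempty_of_card_le (by rwa [Fintype.card_coe])
  -- Agents outside the range of `e`, if any, receive an arbitrary state from the default value of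
  -- `Function.invFun`.
  let s : Fin N → V := fun i => (Function.invFun (⇑e) i : (Bᶜ ∪ T₂ : Finset V))
  have hs : ∀ x ∈ Bᶜ ∪ T₂, ∃ i, s i = x := fun x hx =>
    ⟨e ⟨x, hx⟩, congrArg Subtype.val (Function.leftInverse_invFun e.injective ⟨x, hx⟩)⟩
  refine ⟨s, genericObservable_of_matchable hB
    (fun x hx => hs x (Finset.mem_union_left _ (Finset.mem_compl.2 hx))) fun x => ?_⟩
  obtain ⟨y, hxy, hy⟩ := exists_reachable_parentSCC (G := G) x
  obtain ⟨i, hi⟩ := hs (r ⟨_, hy⟩)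
    (Finset.mem_union_right _ (Finset.mem_image_of_mem r (Finset.mem_univ _)))
  exact ⟨i, hi.symm ▸ hxy.trans (hr ⟨_, hy⟩).1⟩

omit [Fintype V] [DecidableEq V] in
theorem ncard_parentSCCs_pos [Finite V] : 0 < (parentSCCs G).ncard := by
  obtain ⟨y, -, hy⟩ := exists_reachable_parentSCC (G := G) (Classical.arbitrary V)
  exact (Set.ncard_pos (Set.toFinite _)).2 ⟨_, hy⟩

theorem IsMaxMatching.sharedNumber_le (hM : IsMaxMatching G M) :
    sharedNumber G M ≤ (contractions G M).ncard := by
  obtain ⟨T, ⟨⟨c, hc, hcT⟩, -⟩, -, hT⟩ := hM.exists_card_eq_sharedNumber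
  rw [← hT, ← Set.ncard_coe_finset]
  exact Set.ncard_le_ncard_of_injOn c (fun x hx => (hcT x hx).1) hc (Set.toFinite _)

/-- One construction and one bound serve all four minima: generic observability yields the other
three notions, and each of the four implies structural observability. -/
theorem IsMaxMatching.isMinAgents (hM : IsMaxMatching G M) {N : ℕ}
    (hN : (contractions G M).ncard + (parentSCCs G).ncard = N + sharedNumber G M) :
    IsMinAgents G N := by
  obtain ⟨s, hs⟩ := hM.exists_genericObservable hN
  have hpos : 0 < N := by
    have := hM.sharedNumber_le
    have := ncard_parentSCCs_pos (G := G)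
    omega
  have hlow : ∀ {N' : ℕ} {s' : Fin N' → V}, StructObservable G s' → N ≤ N' := fun h => by
    have := hM.le_add_sharedNumber h
    omega
  have hβ : IsNeighborhood fun i : Fin N => {i} := fun i => Finset.mem_singleton_self i
  have hα : IsNeighborhood fun _ : Fin N => Finset.univ := fun i => Finset.mem_univ i
  refine ⟨⟨⟨s, hs.structObservable⟩, ?_⟩, ⟨⟨s, hs⟩, ?_⟩,
    ⟨⟨hpos, s, _, _, hβ, hα, hs.genericDistObservable.structDistObservable hβ⟩, ?_⟩,
    ⟨⟨hpos, s, _, _, hβ, hα, hs.genericDistObservable⟩, ?_⟩⟩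
  · rintro N' ⟨s', h⟩
    exact hlow h
  · rintro N' ⟨s', h⟩
    exact hlow h.structObservable
  · rintro N' ⟨hN', s', β, α, -, -, h⟩
    exact hlow (h.structObservable hN')
  · rintro N' ⟨hN', s', β, α, hβ', -, h⟩
    exact hlow ((h.structDistObservable hβ').structObservable hN')

end Count

end SocialObs

theorem mainTheorem4 {V : Type*} [Fintype V] [DecidableEq V] [Nonempty V] (G : Digraph V)
    (M : Finset (V × V)) (hM : SocialObs.IsMaxMatching G M) :
    -- the general formula `N_min = |𝒞| + |𝒮ᵖ| - |𝒮ᵖ ∩ 𝒞|`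
    (∃ n : ℕ, (n : ℤ) = ((SocialObs.contractions G M).ncard : ℤ)
          + ((SocialObs.parentSCCs G).ncard : ℤ) - (SocialObs.sharedNumber G M : ℤ) ∧
        SocialObs.IsMinAgents G n) ∧
    -- pairwise disjoint contractions: the last term only counts pairs with a common state
    ((SocialObs.contractions G M).PairwiseDisjoint id →
        SocialObs.sharedNumber G M = SocialObs.sharedPairNumber G M) ∧
    -- structurally full-rank digraphs
    (SocialObs.sRank (SocialObs.systemPattern G) = Fintype.card V →
        SocialObs.contractions G M = ∅ ∧
        SocialObs.IsMinAgents G (SocialObs.parentSCCs G).ncard) := by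
  have hle := hM.sharedNumber_le
  refine ⟨?_, hM.sharedNumber_eq_sharedPairNumber, fun hrank => ?_⟩
  · obtain ⟨n, hn⟩ := Nat.exists_eq_add_of_le
      (hle.trans (Nat.le_add_right _ (SocialObs.parentSCCs G).ncard))
    refine ⟨n, by omega, hM.isMinAgents (by omega)⟩
  · have h0 : (SocialObs.contractions G M).ncard = 0 := by
      have := hM.1.ncard_contractions_add
      have := hM.sRank_eq
      omega
    exact ⟨(Set.ncard_eq_zero (Set.toFinite _)).1 h0, hM.isMinAgents (by omega)⟩
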